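/- Let $N,M\ge 1$ be integers and let $P_s,P_r,P_I,N_0>0$; put $\rho_1=P_s/N_0$, $\rho_2=P_r/N_0$, $\rho_I=P_I/N_0$. A single-antenna source reaches a single-antenna destination through an amplify-and-forward relay with $N$ antennas which suffers from $M$ co-channel interferers, each of power $P_I$. Let $\mathbf h_1\in\mathbb C^{N\times 1}$ (source–relay channel), $\mathbf H_I=[\mathbf h_{I1},\dots,\mathbf h_{IM}]\in\mathbb C^{N\times M}$ (interferer–relay channels) and $\mathbf h_2\in\mathbb C^{1\times N}$ (relay–destination channel) be random, with all their entries jointly independent and distributed as $\mathcal{CN}(0,1)$ (circular complex Gaussian with mean zero and unit variance). For a relay matrix $\mathbf W\in\mathbb C^{N\times N}$ the end-to-end SINR is $$\gamma=\frac{|\mathbf h_2\mathbf W\mathbf h_1|^2P_s}{\sum_{i=1}^M|\mathbf h_2\mathbf W\mathbf h_{Ii}|^2P_I+\|\mathbf h_2\mathbf W\|^2N_0+N_0}.$$ The MMSE/MRT scheme uses $\mathbf W=\omega\,\frac{\mathbf h_2^\dagger}{\|\mathbf h_2\|}\mathbf w_1$ with $$\mathbf w_1=\mathbf h_1^\dagger\Big(\mathbf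 h_1\mathbf h_1^\dagger+\mathbf H_I\mathbf H_I^\dagger+\tfrac1{\rho_I}\mathbf I\Big)^{-1},\qquad \omega^2=\frac{\rho_2}{|\mathbf w_1\mathbf h_1|^2\rho_1+\sum_{i=1}^M|\mathbf w_1\mathbf h_{Ii}|^2\rho_I+\|\mathbf w_1\|^2},\quad \omega\ge 0,$$ and $\gamma_{\sf MMSE}$ denotes the resulting SINR. Let $$Z=\frac{|\mathbf w_1\mathbf h_1|^2\rho_1}{\sum_{i=1}^M|\mathbf w_1\mathbf h_{Ii}|^2\rho_I+\|\mathbf w_1\|^2}.$$ Then the c.d.f. of $Z$ is, for every $z\ge 0$, $$F_Z(z)=1-\frac{\Gamma(N,z/\rho_1)}{\Gamma(N)}+\Gamma(M+1)\,e^{-z/\rho_1}\Big(\frac z{\rho_1}\Big)^N\sum_{m=m_1}^N\frac{\rho_I^{N-m+1}\,{}_2F_1\big(M+1,N-m+1;N-m+2;-\frac{\rho_I}{\rho_1}z\big)}{\Gamma(m)\,\Gamma(N-m+2)\,\Gamma(m-N+M)},$$ where $m_1=\max(0,N-M)+1$, $\Gamma(s,x)=\int_x^\infty t^{s-1}e^{-t}\,dt$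 is the upper incomplete gamma function and ${}_2F_1$ is the Gauss hypergeometric function (analytically continued to $(-\infty,1)$). Moreover, for every threshold $\gamma_{\sf th}>0$, the outage probability of the MMSE/MRT scheme satisfies $$\mathrm{Prob}\big(\gamma_{\sf MMSE}<\gamma_{\sf th}\big)\;\ge\;1-\frac{\Gamma(N,\gamma_{\sf th}/\rho_2)}{\Gamma(N)}\,\big(1-F_Z(\gamma_{\sf th})\big).$$ -/

import Mathlib

open MeasureTheory ProbabilityTheory
open scoped Matrix NNReal

/-! ### Special functions -/

/-- The upper incomplete gamma function `Γ(s, x) = ∫_x^∞ t^(s-1) e^(-t) dt`. -/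
noncomputable def upperIncompleteGamma (s x : ℝ) : ℝ :=
  ∫ t in Set.Ioi x, t ^ (s - 1) * Real.exp (-t)

/-- `F` is the (unique) real-analytic continuation to `(-∞, 1)` of the sum of the Gauss
hypergeometric series with parameters `a, b; c`, which converges on `(-1, 1)`. -/
def IsHypergeometricContinuation (a b c : ℝ) (F : ℝ → ℝ) : Prop :=
  AnalyticOnNhd ℝ F (Set.Iio 1) ∧
    Set.EqOn F (ordinaryHypergeometric a b c) (Set.Ioo (-1) 1)

open Classical in
/-- The Gauss hypergeometric function `₂F₁(a, b; c; x)` for real `x < 1`, that is, the sum of the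
hypergeometric series for `|x| < 1` and its analytic continuation for `x ≤ -1`
(where Mathlib's `ordinaryHypergeometric`, the bare sum of the series, has a junk value). -/
noncomputable def gaussHypergeometric (a b c x : ℝ) : ℝ :=
  if h : ∃ F, IsHypergeometricContinuation a b c F then h.choose x else 0

/-! ### Rayleigh fading channels -/

/-- `𝒞𝒩(0, 1)`: the law of a circular complex Gaussian variable of mean zero and unit variance;
its real and imaginary parts are independent real Gaussians of variance `1/2`. -/
noncomputable def stdComplexGaussian : Measure ℂ :=
  ((gaussianReal 0 (1 / 2)).prod (gaussianReal 0 (1 / 2))).map fun p : ℝ × ℝ => (⟨p.1, p.2⟩ : ℂ)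

/-- The list of all scalar channel coefficients: the entries of the source-relay channel `h₁`, of
the interference-relay channels (the columns of `H`) and of the relay-destination channel `h₂`. -/
def channelEntry {Ω : Type*} {N M : ℕ} (h₁ : Ω → Fin N → ℂ) (H : Ω → Matrix (Fin N) (Fin M) ℂ)
    (h₂ : Ω → Fin N → ℂ) : Fin N ⊕ (Fin N × Fin M) ⊕ Fin N → Ω → ℂ
  | Sum.inl j, ω => h₁ ω j
  | Sum.inr (Sum.inl p), ω => H ω p.1 p.2
  | Sum.inr (Sum.inr j), ω => h₂ ω j

/-- All channel coefficients are i.i.d. `𝒞𝒩(0, 1)`. -/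
structure IsRayleighFading {Ω : Type*} [MeasurableSpace Ω] (μ : Measure Ω) {N M : ℕ}
    (h₁ : Ω → Fin N → ℂ) (H : Ω → Matrix (Fin N) (Fin M) ℂ) (h₂ : Ω → Fin N → ℂ) : Prop where
  hasLaw : ∀ k, HasLaw (channelEntry h₁ H h₂ k) stdComplexGaussian μ
  indep : iIndepFun (channelEntry h₁ H h₂) μ

/-! ### The dual-hop amplify-and-forward system, for one channel realization -/

section Realization

variable {N M : ℕ}

/-- The squared Euclidean (Frobenius) norm of a complex vector. -/
noncomputable def frobSq (v : Fin N → ℂ) : ℝ := ∑ j, ‖v j‖ ^ 2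

/-- The end-to-end SINR of the relay system with source power `Ps`, interferer powers `PI i`, noise
power `N₀` and relay transformation matrix `W`. -/
noncomputable def endToEndSINR (Ps : ℝ) (PI : Fin M → ℝ) (N₀ : ℝ) (h₁ : Fin N → ℂ)
    (H : Matrix (Fin N) (Fin M) ℂ) (h₂ : Fin N → ℂ) (W : Matrix (Fin N) (Fin N) ℂ) : ℝ :=
  ‖h₂ ⬝ᵥ (W *ᵥ h₁)‖ ^ 2 * Ps /
    (∑ i, ‖h₂ ⬝ᵥ (W *ᵥ H.col i)‖ ^ 2 * PI i + frobSq (h₂ ᵥ* W) * N₀ + N₀)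

/-- The MMSE combining row vector `w₁ = h₁† (h₁ h₁† + H H† + ρI⁻¹ I)⁻¹`. -/
noncomputable def mmseCombiner (ρI : ℝ) (h₁ : Fin N → ℂ) (H : Matrix (Fin N) (Fin M) ℂ) :
    Fin N → ℂ :=
  star h₁ ᵥ* (Matrix.vecMulVec h₁ (star h₁) + H * Hᴴ + ((1 / ρI : ℝ) : ℂ) • 1)⁻¹

/-- The interference-plus-noise power after combining with `w`, relative to the noise power. -/
noncomputable def combinedInterference (ρI : ℝ) (H : Matrix (Fin N) (Fin M) ℂ)
    (w : Fin N → ℂ) : ℝ :=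
  ∑ i, ‖w ⬝ᵥ H.col i‖ ^ 2 * ρI + frobSq w

/-- The SINR `Z` at the output of the MMSE combiner of the relay. -/
noncomputable def mmseZ (ρ₁ ρI : ℝ) (h₁ : Fin N → ℂ) (H : Matrix (Fin N) (Fin M) ℂ) : ℝ :=
  ‖mmseCombiner ρI h₁ H ⬝ᵥ h₁‖ ^ 2 * ρ₁ / combinedInterference ρI H (mmseCombiner ρI h₁ H)

/-- The power constraint factor `ω` of the MMSE/MRT relay, for which the average transmit power of
the relay equals `Pr = ρ₂ N₀`. -/
noncomputable def mmsePowerFactor (ρ₁ ρ₂ ρI : ℝ) (h₁ : Fin N → ℂ)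
    (H : Matrix (Fin N) (Fin M) ℂ) : ℝ :=
  √(ρ₂ / (‖mmseCombiner ρI h₁ H ⬝ᵥ h₁‖ ^ 2 * ρ₁
    + combinedInterference ρI H (mmseCombiner ρI h₁ H)))

/-- The MMSE/MRT relay matrix `W = ω (h₂† / ‖h₂‖) w₁`. -/
noncomputable def mmseMrtPrecoder (ρ₁ ρ₂ ρI : ℝ) (h₁ : Fin N → ℂ)
    (H : Matrix (Fin N) (Fin M) ℂ) (h₂ : Fin N → ℂ) : Matrix (Fin N) (Fin N) ℂ :=
  ((mmsePowerFactor ρ₁ ρ₂ ρI h₁ H / √(frobSq h₂) : ℝ) : ℂ) •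
    Matrix.vecMulVec (star h₂) (mmseCombiner ρI h₁ H)

/-- The end-to-end SINR of the MMSE/MRT scheme with source, relay and (common) interferer powers
`Ps`, `Pr`, `PI` and noise power `N₀`. -/
noncomputable def mmseMrtSINR (Ps Pr PI N₀ : ℝ) (h₁ : Fin N → ℂ)
    (H : Matrix (Fin N) (Fin M) ℂ) (h₂ : Fin N → ℂ) : ℝ :=
  endToEndSINR Ps (fun _ => PI) N₀ h₁ H h₂
    (mmseMrtPrecoder (Ps / N₀) (Pr / N₀) (PI / N₀) h₁ H h₂)

end Realization

/-! ### Outage probability and the closed-form expressions -/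

/-- The probability that the end-to-end SINR of the MMSE/MRT scheme is below `γth`. -/
noncomputable def mmseMrtOutage {Ω : Type*} [MeasurableSpace Ω] (μ : Measure Ω) {N M : ℕ}
    (h₁ : Ω → Fin N → ℂ) (H : Ω → Matrix (Fin N) (Fin M) ℂ) (h₂ : Ω → Fin N → ℂ)
    (Ps Pr PI N₀ γth : ℝ) : ℝ :=
  μ.real {ω | mmseMrtSINR Ps Pr PI N₀ (h₁ ω) (H ω) (h₂ ω) < γth}

/-- The closed form of the c.d.f. of `Z`. The sum runs over `m₁ ≤ m ≤ N` with
`m₁ = max(0, N - M) + 1`; the subtraction of natural numbers is truncated at `0`. -/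
noncomputable def mmseCdf (N M : ℕ) (ρ₁ ρI z : ℝ) : ℝ :=
  1 - upperIncompleteGamma N (z / ρ₁) / Real.Gamma N +
    Real.Gamma (M + 1) * Real.exp (-(z / ρ₁)) * (z / ρ₁) ^ N *
      ∑ m ∈ Finset.Icc (N - M + 1) N,
        ρI ^ (N - m + 1) *
          gaussHypergeometric (M + 1) ((N : ℝ) - m + 1) ((N : ℝ) - m + 2) (-(ρI / ρ₁ * z)) /
          (Real.Gamma m * Real.Gamma ((N : ℝ) - m + 2) * Real.Gamma ((m : ℝ) - N + M))

/-! Put R(v) = 1 + ρI ∑ v_i v_i†, where the v_i are the interferer columns. The MMSE combiner is a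
positive multiple of h₁† R⁻¹, so Z = ρ₁ · h₁† R⁻¹ h₁ (`mmseZ_eq`), and the task is to find the tail
of this quadratic form.

For fixed v, the substitution k = R^{-1/2} h₁ turns the tail into the integral over |k|² > x of det
R(v) · exp(-ρI ∑ |k† v_i|²) against the standard Gaussian law. Tonelli then lets the columns be
integrated first, with k fixed. The exponential tilts each column to a Gaussian of covariance S = (1
+ ρI k k†)⁻¹, at the price of a factor (1 + ρI |k|²)⁻¹ per column, and an expected determinant
remains. By the matrix determinant lemma and Jacobi's formula, averaging over one random column
applies 1 + ρI d/dX to det(B + X S). Hence M columns give (1 + ρI d/dX)^M, taken at X = 0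
(`integral_coeff_pencilDet_gram`). Since det(1 + X S) is explicit, so is the result, and it depends
on k only through |k|², which is Gamma distributed.

The resulting density is minus the derivative of e^{-x} P(x) / (1 + ρI x)^M, where P truncates the
series of (1 + ρI t)^M e^t to degree below N (`hasDerivAt_tailFun`). The stated formula agrees with
this because ₂F₁(M+1, s+1; s+2; ·) is rational for s < M: up to a monomial factor it is the tail of
a binomial expansion divided by the whole (`mmseCdf_eq`).

For the outage, the end-to-end SINR is ab/(a + b + 1), with a = Z and b = ρ₂ |h₂|². It lies below γ
as soon as a ≤ γ or b ≤ γ, and a and b are independent. -/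

/-! ### Rank-one updates and derivatives of determinants. -/

section Determinants

variable {n R : Type*} [Fintype n] [DecidableEq n] [CommRing R]

/-- Multilinearity in the columns, added one at a time. The expansion stops at first order because
two columns proportional to `u` make a determinant vanish. -/
lemma det_add_sum_cols (A : Matrix n n R) (u v : n → R) (s : Finset n) :
    (Matrix.of fun i j => A i j + if j ∈ s then u i * v j else 0).det =
      A.det + ∑ i ∈ s, v i * (A.updateCol i u).det := by
  induction s using Finset.induction_on with
  | empty => simp; rfl
  | insert k s hk ih =>
    set As : Matrix n n R := Matrix.of fun i j => A i j + if j ∈ s then u i * v j else 0 with hAs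
    have h1 : (Matrix.of fun i j => A i j + if j ∈ insert k s then u i * v j else 0) =
        As.updateCol k ((fun i => As i k) + v k • u) := by
      ext i j
      by_cases hj : j = k
      · subst hj; simp [hAs, hk, mul_comm]
      · simp [hAs, hj, Finset.mem_insert]
    -- Once column `k` is `u`, the perturbations of the other columns are multiples of it and can be
    -- subtracted off.
    have h2 : (As.updateCol k u).det = (A.updateCol k u).det := by
      rw [← Matrix.det_transpose, ← Matrix.det_transpose (A.updateCol k u)]
      refine Matrix.det_eq_of_forall_row_eq_smul_add_const (fun j => if j ∈ s then v j else 0) k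
        ?_ fun j i => ?_
      · simp [hk]
      · by_cases hj : j = k
        · subst hj; simp [hk]
        · by_cases hs : j ∈ s <;> simp [hAs, hj, hs, mul_comm]
    rw [h1, Matrix.det_updateCol_add, Matrix.det_updateCol_smul, h2, Finset.sum_insert hk,
      show (fun i => As i k) = As.col k from rfl]
    have h3 : As.updateCol k (As.col k) = As := by
      ext i j; by_cases hj : j = k
      · subst hj; simp
      · simp [hj]
    rw [h3, ih]; ring

/-- The matrix determinant lemma over a commutative ring. -/
lemma Matrix.det_add_vecMulVec_eq (A : Matrix n n R) (u v : n → R) :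
    (A + Matrix.vecMulVec u v).det = A.det + ∑ a, ∑ b, u a * v b * A.adjugate b a := by
  have h := det_add_sum_cols A u v Finset.univ
  have h1 : (Matrix.of fun i j => A i j + if j ∈ Finset.univ then u i * v j else 0) =
      A + Matrix.vecMulVec u v := by
    ext i j; simp [Matrix.vecMulVec]
  rw [h1] at h
  rw [h, Finset.sum_comm]
  congr 1
  refine Finset.sum_congr rfl fun b _ => ?_
  rw [← Matrix.cramer_apply, Matrix.cramer_eq_adjugate_mulVec, Matrix.mulVec, dotProduct,
    Finset.mul_sum]
  exact Finset.sum_congr rfl fun a _ => by ring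

open Polynomial in
lemma derivative_det_eq_sum_updateCol (A : Matrix n n R[X]) :
    derivative A.det = ∑ i, (A.updateCol i fun j => derivative (A j i)).det := by
  simp_rw [Matrix.det_apply, derivative_sum, derivative_smul, derivative_prod_finset,
    Finset.smul_sum]
  rw [Finset.sum_comm]
  refine Finset.sum_congr rfl fun i _ => Finset.sum_congr rfl fun σ _ => ?_
  have h := Finset.mul_prod_erase Finset.univ
    (fun x => (A.updateCol i fun j => derivative (A j i)) (σ x) x) (Finset.mem_univ i)
  refine congrArg (Equiv.Perm.sign σ • ·) (Eq.trans ?_ h)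
  simp only [Matrix.updateCol_self]
  rw [mul_comm]
  refine congrArg (derivative (A (σ i) i) * ·) (Finset.prod_congr rfl fun j hj => ?_)
  rw [Matrix.updateCol_ne (Finset.ne_of_mem_erase hj)]

open Polynomial in
/-- Jacobi's formula along a line. -/
lemma derivative_det_add_X_smul (B S : Matrix n n R) :
    derivative (B.map C + (X : R[X]) • S.map C).det =
      ∑ a, ∑ b, C (S a b) * (B.map C + (X : R[X]) • S.map C).adjugate b a := by
  rw [derivative_det_eq_sum_updateCol, Finset.sum_comm]
  refine Finset.sum_congr rfl fun b _ => ?_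
  rw [← Matrix.cramer_apply, Matrix.cramer_eq_adjugate_mulVec, Matrix.mulVec, dotProduct]
  refine Finset.sum_congr rfl fun a _ => ?_
  rw [mul_comm, Matrix.add_apply, Matrix.smul_apply, Matrix.map_apply, Matrix.map_apply,
    smul_eq_mul, derivative_add, derivative_C, derivative_mul, derivative_C, derivative_X]
  ring

end Determinants

/-! ### Densities of finite product measures. -/

section ProductDensities

lemma lintegral_fin_prod_eq_prod {n : ℕ} {E : Type*} [MeasurableSpace E] (μ : Measure E)
    [SigmaFinite μ] (f : Fin n → E → ENNReal) (hf : ∀ i, Measurable (f i)) :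
    ∫⁻ x : Fin n → E, ∏ i, f i (x i) ∂(Measure.pi fun _ => μ) = ∏ i, ∫⁻ x, f i x ∂μ := by
  induction n with
  | zero => simp
  | succ n ih =>
    rw [← ((measurePreserving_piFinSuccAbove (fun _ : Fin (n + 1) => μ) 0).symm).lintegral_comp_emb
      (MeasurableEquiv.measurableEmbedding _)]
    simp_rw [MeasurableEquiv.piFinSuccAbove_symm_apply, Fin.insertNthEquiv,
      Fin.prod_univ_succ, Fin.insertNth_zero, Equiv.coe_fn_mk, Fin.cons_succ,
      Fin.cons_zero]
    rw [← ih _ fun i => hf _]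
    exact lintegral_prod_mul (hf 0).aemeasurable
      (Finset.measurable_prod _ fun i _ => (hf _).comp (measurable_pi_apply i)).aemeasurable

/-- It suffices to compare the measures on boxes, whose indicators factor over the coordinates. -/
lemma pi_withDensity {n : ℕ} {E : Type*} [MeasurableSpace E] (μ : Measure E)
    [SigmaFinite μ] (f : E → ENNReal) (hf : Measurable f) [SigmaFinite (μ.withDensity f)] :
    (Measure.pi fun _ : Fin n => μ.withDensity f) =
      (Measure.pi fun _ : Fin n => μ).withDensity fun x => ∏ i, f (x i) := by
  refine Measure.pi_eq fun s hs => ?_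
  rw [withDensity_apply _ (MeasurableSet.univ_pi hs), ← lintegral_indicator (MeasurableSet.univ_pi hs)]
  have : (Set.univ.pi s).indicator (fun x => ∏ i, f (x i)) =
      fun x : Fin n → E => ∏ i, (s i).indicator f (x i) := by
    ext x
    by_cases hx : x ∈ Set.univ.pi s
    · rw [Set.indicator_of_mem hx]
      exact Finset.prod_congr rfl fun i _ => (Set.indicator_of_mem (hx i trivial) f).symm
    · rw [Set.indicator_of_notMem hx]
      simp only [Set.mem_pi, Set.mem_univ, true_imp_iff, not_forall] at hx
      obtain ⟨i, hi⟩ := hx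
      exact (Finset.prod_eq_zero (Finset.mem_univ i) (Set.indicator_of_notMem hi f)).symm
  rw [this, lintegral_fin_prod_eq_prod μ _ fun i => hf.indicator (hs i)]
  exact Finset.prod_congr rfl fun i _ => by
    rw [lintegral_indicator (hs i), withDensity_apply _ (hs i)]

end ProductDensities

/-! ### Gaussian vectors and linear changes of variable. -/

section ComplexGaussian

lemma stdComplexGaussian_eq_withDensity :
    stdComplexGaussian =
      volume.withDensity fun z : ℂ => ENNReal.ofReal (Real.pi⁻¹ * Real.exp (-‖z‖ ^ 2)) := by
  have h2 : ((1 / 2 : ℝ≥0)) ≠ 0 := by norm_num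
  have hmp := Complex.volume_preserving_equiv_real_prod.symm
  have hm : Measurable fun z : ℂ => ENNReal.ofReal (Real.pi⁻¹ * Real.exp (-‖z‖ ^ 2)) := by fun_prop
  rw [stdComplexGaussian, gaussianReal_of_var_ne_zero _ h2,
    prod_withDensity (measurable_gaussianPDF _ _) (measurable_gaussianPDF _ _)]
  change Measure.map Complex.measurableEquivRealProd.symm _ = _
  ext s hs
  rw [Measure.map_apply (MeasurableEquiv.measurable _) hs,
    withDensity_apply _ (MeasurableEquiv.measurable _ hs), withDensity_apply _ hs,
    ← hmp.setLIntegral_comp_preimage hs hm]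
  refine lintegral_congr fun p => ?_
  rw [gaussianPDF, gaussianPDF, ← ENNReal.ofReal_mul (gaussianPDFReal_nonneg _ _ _)]
  congr 1
  have hn : ‖Complex.measurableEquivRealProd.symm p‖ ^ 2 = p.1 ^ 2 + p.2 ^ 2 := by
    rw [← Complex.normSq_eq_norm_sq, Complex.normSq_apply]
    simp [Complex.measurableEquivRealProd]; ring
  rw [hn, gaussianPDFReal, gaussianPDFReal]
  have hs : (√(2 * Real.pi * ((1 / 2 : ℝ≥0) : ℝ)))⁻¹ * (√(2 * Real.pi * ((1 / 2 : ℝ≥0) : ℝ)))⁻¹ =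
      Real.pi⁻¹ := by
    rw [← mul_inv, Real.mul_self_sqrt (by positivity)]
    push_cast; congr 1; ring
  rw [mul_mul_mul_comm, hs, ← Real.exp_add]
  push_cast
  congr 2; ring

instance : IsProbabilityMeasure stdComplexGaussian :=
  Measure.isProbabilityMeasure_map (by
    exact (Complex.measurableEquivRealProd.symm.measurable).aemeasurable)

/-- The law of a vector of `N` independent `𝒞𝒩(0, 1)` entries. -/
noncomputable abbrev gaussianVec (N : ℕ) : Measure (Fin N → ℂ) :=
  Measure.pi fun _ => stdComplexGaussian

variable {N : ℕ}

lemma measurable_frobSq : Measurable (frobSq : (Fin N → ℂ) → ℝ) := by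
  unfold frobSq; fun_prop

lemma frobSq_nonneg (v : Fin N → ℂ) : 0 ≤ frobSq v :=
  Finset.sum_nonneg fun _ _ => sq_nonneg _

lemma dotProduct_star_self_eq_frobSq (v : Fin N → ℂ) : star v ⬝ᵥ v = (frobSq v : ℂ) := by
  simp only [dotProduct, frobSq, Complex.ofReal_sum, Pi.star_apply, RCLike.star_def,
    Complex.conj_mul', Complex.ofReal_pow]

lemma gaussianVec_eq_withDensity :
    gaussianVec N = volume.withDensity fun v : Fin N → ℂ =>
      ENNReal.ofReal (Real.pi⁻¹ ^ N * Real.exp (-frobSq v)) := by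
  have hm : Measurable fun z : ℂ => ENNReal.ofReal (Real.pi⁻¹ * Real.exp (-‖z‖ ^ 2)) := by fun_prop
  have : SigmaFinite (volume.withDensity fun z : ℂ =>
      ENNReal.ofReal (Real.pi⁻¹ * Real.exp (-‖z‖ ^ 2))) := by
    rw [← stdComplexGaussian_eq_withDensity]; infer_instance
  unfold gaussianVec
  rw [stdComplexGaussian_eq_withDensity, pi_withDensity _ _ hm]
  rw [← volume_pi]
  congr 1
  ext v
  rw [← ENNReal.ofReal_prod_of_nonneg fun i _ => by positivity, Finset.prod_mul_distrib,
    Finset.prod_const, Finset.card_univ, Fintype.card_fin, ← Real.exp_sum, frobSq,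
    Finset.sum_neg_distrib]

/-- The real Jacobian of a complex-linear map is the norm from ℂ to ℝ of its complex determinant. -/
lemma det_mulVecLin_restrictScalars (Q : Matrix (Fin N) (Fin N) ℂ) :
    LinearMap.det (Q.mulVecLin.restrictScalars ℝ) = ‖Q.det‖ ^ 2 := by
  rw [LinearMap.det_restrictScalars, Algebra.norm_complex_eq]
  rw [← Complex.normSq_eq_norm_sq]
  change Complex.normSq (LinearMap.det Q.mulVecLin) = _
  rw [← Matrix.toLin'_apply', LinearMap.det_toLin']

lemma measurable_mulVec (Q : Matrix (Fin N) (Fin N) ℂ) : Measurable fun k => Q *ᵥ k :=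
  (Continuous.matrix_mulVec continuous_const continuous_id).measurable

/-- The law of an invertible linear transform of a Gaussian vector. -/
lemma map_inv_mulVec_gaussianVec (Q : Matrix (Fin N) (Fin N) ℂ) (hQ : Q.det ≠ 0) :
    (gaussianVec N).map (fun k => Q⁻¹ *ᵥ k) = (gaussianVec N).withDensity fun k =>
      ENNReal.ofReal (‖Q.det‖ ^ 2 * Real.exp (frobSq k - frobSq (Q *ᵥ k))) := by
  have hu : IsUnit Q.det := isUnit_iff_ne_zero.mpr hQ
  have hd : LinearMap.det (Q⁻¹.mulVecLin.restrictScalars ℝ) = (‖Q.det‖ ^ 2)⁻¹ := by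
    rw [det_mulVecLin_restrictScalars, Matrix.det_nonsing_inv, Ring.inverse_eq_inv', norm_inv,
      inv_pow]
  have hvol := Measure.map_linearMap_addHaar_eq_smul_addHaar (volume : Measure (Fin N → ℂ))
    (f := Q⁻¹.mulVecLin.restrictScalars ℝ) (by rw [hd]; positivity)
  rw [hd, inv_inv, abs_of_nonneg (by positivity)] at hvol
  have hmf := measurable_frobSq (N := N)
  have hmQ := measurable_mulVec Q
  have hmQi := measurable_mulVec Q⁻¹
  have hg : Measurable fun v : Fin N → ℂ => ENNReal.ofReal (Real.pi⁻¹ ^ N * Real.exp (-frobSq v)) :=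
    by fun_prop
  rw [gaussianVec_eq_withDensity, ← withDensity_mul _ hg (by fun_prop)]
  ext s hs
  rw [Measure.map_apply hmQi hs, withDensity_apply _ (hmQi hs), withDensity_apply _ hs,
    ← lintegral_indicator (hmQi hs), ← lintegral_indicator hs]
  -- `G` is chosen so that `G (Q⁻¹ k)` is the original density at `k` cut off to the preimage of
  -- `s`; the substitution then contributes only the Jacobian.
  set G : (Fin N → ℂ) → ENNReal := s.indicator fun k =>
    ENNReal.ofReal (Real.pi⁻¹ ^ N * Real.exp (-frobSq (Q *ᵥ k))) with hG
  have hGm : Measurable G := Measurable.indicator (by fun_prop) hs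
  have e1 : ∀ k, ((fun k => Q⁻¹ *ᵥ k) ⁻¹' s).indicator (fun v : Fin N → ℂ =>
      ENNReal.ofReal (Real.pi⁻¹ ^ N * Real.exp (-frobSq v))) k =
      G ((Q⁻¹.mulVecLin.restrictScalars ℝ) k) := by
    intro k
    change _ = G (Q⁻¹ *ᵥ k)
    simp only [hG, Set.indicator, Set.mem_preimage, Matrix.mulVec_mulVec,
      Matrix.mul_nonsing_inv Q hu, Matrix.one_mulVec]
    rfl
  simp_rw [e1]
  rw [← lintegral_map hGm (by exact hmQi), hvol, lintegral_smul_measure, smul_eq_mul,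
    ← lintegral_const_mul _ hGm]
  refine lintegral_congr fun k => ?_
  by_cases hk : k ∈ s
  · simp only [hG, Set.indicator_of_mem hk, Pi.mul_apply]
    rw [← ENNReal.ofReal_mul (by positivity), ← ENNReal.ofReal_mul (by positivity)]
    congr 1
    rw [sub_eq_add_neg, Real.exp_add, Real.exp_neg (frobSq k)]
    field_simp
  · simp only [hG, Set.indicator_of_notMem hk, mul_zero]

open scoped MatrixOrder ComplexOrder in
/-- A positive definite precision matrix `R` is realised by the transform `R^{-1/2}`. -/
lemma exists_map_gaussianVec_eq_withDensity (R : Matrix (Fin N) (Fin N) ℂ) (hR : R.PosDef) :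
    ∃ T : Matrix (Fin N) (Fin N) ℂ, Tᴴ = T ∧ T * T = R⁻¹ ∧
      (gaussianVec N).map (fun k => T *ᵥ k) = (gaussianVec N).withDensity fun k =>
        ENNReal.ofReal (R.det.re * Real.exp (frobSq k - (star k ⬝ᵥ (R *ᵥ k)).re)) := by
  set Q := CFC.sqrt R with hQdef
  have hQQ : Q * Q = R := CFC.sqrt_mul_sqrt_self R hR.posSemidef.nonneg
  have hQh : Qᴴ = Q := (Matrix.nonneg_iff_posSemidef.mp (CFC.sqrt_nonneg R)).1
  have hdet : Q.det * Q.det = R.det := by rw [← Matrix.det_mul, hQQ]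
  have hQ0 : Q.det ≠ 0 := by
    intro h; rw [h, zero_mul] at hdet; exact hR.det_pos.ne hdet
  -- `Q` is Hermitian, so det Q equals its own conjugate and det R = |det Q|².
  have hre : R.det.re = ‖Q.det‖ ^ 2 := by
    have : R.det = star Q.det * Q.det := by
      rw [← Matrix.det_conjTranspose, hQh, hdet]
    rw [this, RCLike.star_def, Complex.conj_mul', ← Complex.ofReal_pow, Complex.ofReal_re]
  refine ⟨Q⁻¹, ?_, ?_, ?_⟩
  · rw [Matrix.conjTranspose_nonsing_inv, hQh]
  · rw [← Matrix.mul_inv_rev, hQQ]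
  · rw [map_inv_mulVec_gaussianVec Q hQ0, hre]
    congr 1; ext k; congr 4
    rw [← hQQ, ← Matrix.mulVec_mulVec, Matrix.dotProduct_mulVec]
    have : star k ᵥ* Q = star (Q *ᵥ k) := by
      rw [Matrix.star_mulVec, hQh]
    rw [this, dotProduct_star_self_eq_frobSq, Complex.ofReal_re]

end ComplexGaussian

/-! ### Rings of random variables with all moments finite. -/

section Moments

variable {Ω : Type*} [MeasurableSpace Ω]

/-- The ring of complex random variables all of whose moments are finite. -/
def momentSubring (μ : Measure Ω) [IsFiniteMeasure μ] : Subring (Ω → ℂ) where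
  carrier := {f | ∀ p : ℕ, MemLp f p μ}
  mul_mem' {f g} hf hg p := by
    -- Hölder with 1/(2p) + 1/(2p) = 1/p: requiring all moments at once is what makes the set closed
    -- under products.
    have : ENNReal.HolderTriple ((2 * p : ℕ) : ENNReal) ((2 * p : ℕ) : ENNReal) (p : ENNReal) := by
      constructor
      rw [← two_mul, Nat.cast_mul, ENNReal.mul_inv (by simp) (by simp), ← mul_assoc]
      simp [ENNReal.mul_inv_cancel]
    exact (hg (2 * p)).mul (hf (2 * p))
  one_mem' p := memLp_const 1
  add_mem' hf hg p := (hf p).add (hg p)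
  zero_mem' p := MemLp.zero
  neg_mem' hf p := (hf p).neg

lemma const_mem_momentSubring (μ : Measure Ω) [IsFiniteMeasure μ] (c : ℂ) :
    (fun _ => c) ∈ momentSubring μ := fun _ => memLp_const c

lemma integrable_of_mem_momentSubring {μ : Measure Ω} [IsFiniteMeasure μ] {f : Ω → ℂ}
    (hf : f ∈ momentSubring μ) : Integrable f μ := by
  have := hf 1
  rwa [Nat.cast_one, memLp_one_iff_integrable] at this

lemma star_mem_momentSubring {μ : Measure Ω} [IsFiniteMeasure μ] {f : Ω → ℂ}
    (hf : f ∈ momentSubring μ) : (fun x => star (f x)) ∈ momentSubring μ :=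
  fun p => (hf p).star

open Polynomial in
/-- The ring of random polynomials all of whose coefficients have finite moments. -/
noncomputable def polyMomentSubring (μ : Measure Ω) [IsFiniteMeasure μ] : Subring (Ω → ℂ[X]) where
  carrier := {f | ∀ j, (fun x => (f x).coeff j) ∈ momentSubring μ}
  mul_mem' {f g} hf hg j := by
    have : (fun x => ((f * g) x).coeff j) =
        ∑ p ∈ Finset.HasAntidiagonal.antidiagonal j, (fun x => (f x).coeff p.1) * fun x => (g x).coeff p.2 := by
      ext x; simp [Polynomial.coeff_mul]
    rw [this]
    exact Subring.sum_mem _ fun p _ => mul_mem (hf p.1) (hg p.2)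
  one_mem' j := const_mem_momentSubring μ _
  add_mem' {f g} hf hg j := by
    simp only [Pi.add_apply, coeff_add]
    exact add_mem (hf j) (hg j)
  zero_mem' j := const_mem_momentSubring μ _
  neg_mem' {f} hf j := by
    simp only [Pi.neg_apply, coeff_neg]
    exact neg_mem (hf j)

open Polynomial in
lemma const_mem_polyMomentSubring (μ : Measure Ω) [IsFiniteMeasure μ] (c : ℂ[X]) :
    (fun _ => c) ∈ polyMomentSubring μ := fun _ => const_mem_momentSubring μ _

open Polynomial in
lemma C_mem_polyMomentSubring {μ : Measure Ω} [IsFiniteMeasure μ] {f : Ω → ℂ}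
    (hf : f ∈ momentSubring μ) : (fun x => C (f x)) ∈ polyMomentSubring μ := by
  intro j
  simp_rw [coeff_C]
  split_ifs
  · exact hf
  · exact const_mem_momentSubring μ 0

open Polynomial in
-- A determinant is a polynomial in its entries, so ring closure settles every later integrability
-- question about random determinants.
lemma det_mem_polyMomentSubring {μ : Measure Ω} [IsFiniteMeasure μ] {n : Type*} [Fintype n]
    [DecidableEq n] {A : Ω → Matrix n n ℂ[X]}
    (hA : ∀ i j, (fun x => A x i j) ∈ polyMomentSubring μ) :
    (fun x => (A x).det) ∈ polyMomentSubring μ := by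
  have : (fun x => (A x).det) = ∑ σ : Equiv.Perm n,
      ((Equiv.Perm.sign σ : ℤ) : Ω → ℂ[X]) * ∏ i, fun x => A x (σ i) i := by
    ext1 x; simp [Matrix.det_apply']
  rw [this]
  exact Subring.sum_mem _ fun σ _ => mul_mem (intCast_mem _ _) (Subring.prod_mem _ fun i _ => hA _ _)

lemma momentSubring_comp {Ω' : Type*} [MeasurableSpace Ω'] {μ : Measure Ω} {ν : Measure Ω'}
    [IsFiniteMeasure μ] [IsFiniteMeasure ν] {g : Ω → Ω'} (hg : MeasurePreserving g μ ν)
    {f : Ω' → ℂ} (hf : f ∈ momentSubring ν) : (fun x => f (g x)) ∈ momentSubring μ :=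
  fun p => (hf p).comp_measurePreserving hg

end Moments

/-! ### First and second moments of Gaussian vectors. -/

section GaussianMoments

lemma id_mem_momentSubring_stdComplexGaussian :
    (fun z : ℂ => z) ∈ momentSubring stdComplexGaussian := by
  intro p
  have hm : Measurable fun p : ℝ × ℝ => (⟨p.1, p.2⟩ : ℂ) :=
    Complex.measurableEquivRealProd.symm.measurable
  have hR : MemLp (fun x : ℝ => (x : ℂ)) p (gaussianReal 0 (1 / 2)) :=
    (memLp_id_gaussianReal (μ := 0) (v := 1 / 2) (p : ℝ≥0)).ofReal
  rw [stdComplexGaussian, memLp_map_measure_iff (by fun_prop) hm.aemeasurable]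
  have h : ((fun z : ℂ => z) ∘ fun p : ℝ × ℝ => (⟨p.1, p.2⟩ : ℂ)) =
      fun p : ℝ × ℝ => (p.1 : ℂ) + (p.2 : ℂ) * Complex.I := by
    ext p; exact Complex.mk_eq_add_mul_I _ _
  rw [h]
  exact (hR.comp_fst _).add ((hR.comp_snd _).mul_const Complex.I)

lemma integral_id_stdComplexGaussian : ∫ z, z ∂stdComplexGaussian = 0 := by
  have hm : Measurable fun p : ℝ × ℝ => (⟨p.1, p.2⟩ : ℂ) :=
    Complex.measurableEquivRealProd.symm.measurable
  have hR : Integrable (fun x : ℝ => (x : ℂ)) (gaussianReal 0 (1 / 2)) := by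
    have := (memLp_id_gaussianReal (μ := 0) (v := 1 / 2) 1).ofReal (K := ℂ)
    exact memLp_one_iff_integrable.mp (by simpa using this)
  have h0 : ∫ x : ℝ, (x : ℂ) ∂(gaussianReal 0 (1 / 2)) = 0 := by
    rw [integral_complex_ofReal, integral_id_gaussianReal]; simp
  rw [stdComplexGaussian, integral_map hm.aemeasurable (by fun_prop)]
  simp_rw [Complex.mk_eq_add_mul_I]
  rw [integral_add (hR.comp_fst _) ((hR.comp_snd _).mul_const _),
    integral_fun_fst (f := fun x : ℝ => (x : ℂ)), integral_mul_const,
    integral_fun_snd (f := fun x : ℝ => (x : ℂ)), h0]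
  simp

lemma integral_mul_star_stdComplexGaussian : ∫ z, z * star z ∂stdComplexGaussian = 1 := by
  have hm : Measurable fun p : ℝ × ℝ => (⟨p.1, p.2⟩ : ℂ) :=
    Complex.measurableEquivRealProd.symm.measurable
  have hR : Integrable (fun x : ℝ => x ^ 2) (gaussianReal 0 (1 / 2)) :=
    (memLp_id_gaussianReal (μ := 0) (v := 1 / 2) 2).integrable_sq
  have h0 : ∫ x : ℝ, x ^ 2 ∂(gaussianReal 0 (1 / 2)) = 1 / 2 := by
    have := variance_id_gaussianReal (μ := 0) (v := 1 / 2)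
    rw [variance_of_integral_eq_zero aemeasurable_id (by simp)] at this
    simpa using this
  rw [stdComplexGaussian, integral_map hm.aemeasurable (by fun_prop)]
  have : ∀ p : ℝ × ℝ, (⟨p.1, p.2⟩ : ℂ) * star (⟨p.1, p.2⟩ : ℂ) = ((p.1 ^ 2 + p.2 ^ 2 : ℝ) : ℂ) := by
    intro p
    rw [RCLike.star_def, Complex.mul_conj, Complex.normSq_apply]
    push_cast; ring
  simp_rw [this]
  rw [integral_complex_ofReal, integral_add (hR.comp_fst _) (hR.comp_snd _),
    integral_fun_fst (f := fun x : ℝ => x ^ 2), integral_fun_snd (f := fun x : ℝ => x ^ 2), h0]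
  norm_num

variable {N : ℕ}

lemma coord_mem_momentSubring_gaussianVec (a : Fin N) :
    (fun h : Fin N → ℂ => h a) ∈ momentSubring (gaussianVec N) :=
  momentSubring_comp (measurePreserving_eval (fun _ : Fin N => stdComplexGaussian) a)
    id_mem_momentSubring_stdComplexGaussian

lemma integral_mul_star_gaussianVec (a b : Fin N) :
    ∫ h, h a * star (h b) ∂(gaussianVec N) = if a = b then 1 else 0 := by
  split_ifs with hab
  · subst hab
    rw [← integral_mul_star_stdComplexGaussian]
    exact integral_comp_eval (μ := fun _ : Fin N => stdComplexGaussian) (i := a)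
      (f := fun z : ℂ => z * star z) (by fun_prop)
  -- Written as a product over all coordinates, the integral factors, and the factor at `a` has mean
  -- zero.
  · have h1 : ∀ h : Fin N → ℂ, h a * star (h b) =
        ∏ i, (fun z : ℂ => if i = a then z else if i = b then star z else 1) (h i) := by
      intro h
      rw [← Finset.mul_prod_erase _ _ (Finset.mem_univ a),
        ← Finset.mul_prod_erase _ _ (Finset.mem_erase.mpr ⟨Ne.symm hab, Finset.mem_univ b⟩),
        Finset.prod_eq_one]
      · simp [Ne.symm hab]
      · intro i hi
        simp only [Finset.mem_erase] at hi
        simp [hi.1, hi.2.1]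
    rw [integral_congr_ae (ae_of_all _ h1), integral_fintype_prod_eq_prod (fun i : Fin N =>
      fun z : ℂ => if i = a then z else if i = b then star z else 1)]
    refine Finset.prod_eq_zero (Finset.mem_univ a) ?_
    simp [integral_id_stdComplexGaussian]

lemma coord_mem_momentSubring_map (T : Matrix (Fin N) (Fin N) ℂ) (a : Fin N) :
    (fun h : Fin N → ℂ => (T *ᵥ h) a) ∈ momentSubring (gaussianVec N) := by
  have : (fun h : Fin N → ℂ => (T *ᵥ h) a) = ∑ c, (fun _ => T a c) * fun h : Fin N → ℂ => h c := by
    ext h; simp [Matrix.mulVec, dotProduct]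
  rw [this]
  exact Subring.sum_mem _ fun c _ =>
    mul_mem (const_mem_momentSubring _ _) (coord_mem_momentSubring_gaussianVec c)

lemma integral_mul_star_map (T : Matrix (Fin N) (Fin N) ℂ) (a b : Fin N) :
    ∫ h, (T *ᵥ h) a * star ((T *ᵥ h) b) ∂(gaussianVec N) = (T * Tᴴ) a b := by
  have h1 : ∀ h : Fin N → ℂ, (T *ᵥ h) a * star ((T *ᵥ h) b) =
      ∑ c, ∑ d, T a c * star (T b d) * (h c * star (h d)) := by
    intro h
    simp only [Matrix.mulVec, dotProduct, star_sum, star_mul', Finset.sum_mul_sum]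
    exact Finset.sum_congr rfl fun c _ => Finset.sum_congr rfl fun d _ => by ring
  have hI : ∀ c d : Fin N, Integrable (fun h : Fin N → ℂ => T a c * star (T b d) *
      (h c * star (h d))) (gaussianVec N) := fun c d =>
    (integrable_of_mem_momentSubring (mul_mem (coord_mem_momentSubring_gaussianVec c)
      (star_mem_momentSubring (coord_mem_momentSubring_gaussianVec d)))).const_mul _
  simp_rw [h1]
  rw [integral_finsetSum _ fun c _ => integrable_finsetSum _ fun d _ => hI c d]
  simp_rw [integral_finsetSum _ fun d _ => hI _ d, integral_const_mul,
    integral_mul_star_gaussianVec]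
  simp [Matrix.mul_apply]

end GaussianMoments

/-! ### Expected determinants of random Gram pencils. -/

section ExpectedDeterminant

open Polynomial

variable {n : Type*} [Fintype n] [DecidableEq n]

/-- The determinant of the pencil `B + X S`, as a polynomial in `X`. -/
noncomputable def pencilDet (S B : Matrix n n ℂ) : ℂ[X] :=
  (B.map C + (X : ℂ[X]) • S.map C).det

/-- The differential operator `1 + ρ d/dX`. -/
noncomputable def addDeriv (ρ : ℂ) (p : ℂ[X]) : ℂ[X] := p + C ρ * derivative p

lemma coeff_addDeriv (ρ : ℂ) (p : ℂ[X]) (j : ℕ) :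
    (addDeriv ρ p).coeff j = p.coeff j + ρ * (p.coeff (j + 1) * (j + 1)) := by
  simp [addDeriv, coeff_derivative]

lemma pencilDet_add_vecMulVec (S B : Matrix n n ℂ) (ρ : ℂ) (u w : n → ℂ) :
    pencilDet S (B + ρ • Matrix.vecMulVec u w) = pencilDet S B +
      ∑ a, ∑ b, C (ρ * (u a * w b)) * (B.map C + (X : ℂ[X]) • S.map C).adjugate b a := by
  have : (B + ρ • Matrix.vecMulVec u w).map C + (X : ℂ[X]) • S.map C =
      (B.map C + (X : ℂ[X]) • S.map C) +
        Matrix.vecMulVec (fun i => C (ρ * u i)) (fun i => C (w i)) := by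
    ext1 i j
    simp only [Matrix.add_apply, Matrix.map_apply, Matrix.smul_apply, Matrix.vecMulVec_apply,
      smul_eq_mul, C_add, C_mul]
    ring
  rw [pencilDet, this, Matrix.det_add_vecMulVec_eq, pencilDet]
  simp only [C_mul, mul_assoc]

variable {Ω : Type*} [MeasurableSpace Ω] {ν : Measure Ω}

lemma pencilDet_mem_polyMomentSubring [IsFiniteMeasure ν] {S : Matrix n n ℂ}
    {A : Ω → Matrix n n ℂ} (hA : ∀ a b, (fun x => A x a b) ∈ momentSubring ν) :
    (fun x => pencilDet S (A x)) ∈ polyMomentSubring ν := by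
  refine det_mem_polyMomentSubring fun i j => ?_
  simp only [Matrix.add_apply, Matrix.map_apply, Matrix.smul_apply]
  exact add_mem (C_mem_polyMomentSubring (hA i j)) (const_mem_polyMomentSubring ν _)

omit [Fintype n] [DecidableEq n] in
lemma gram_mem_momentSubring [IsProbabilityMeasure ν] {u : Ω → n → ℂ}
    (hu : ∀ a, (fun x => u x a) ∈ momentSubring ν) (M : ℕ) (B : Matrix n n ℂ) (ρ : ℂ) (a b : n) :
    (fun v : Fin M → Ω => (B + ρ • ∑ i, Matrix.vecMulVec (u (v i)) (star (u (v i)))) a b) ∈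
      momentSubring (Measure.pi fun _ : Fin M => ν) := by
  have : (fun v : Fin M → Ω => (B + ρ • ∑ i, Matrix.vecMulVec (u (v i)) (star (u (v i)))) a b) =
      (fun _ => B a b) + (fun _ => ρ) * ∑ i, (fun v : Fin M → Ω => u (v i) a) *
        fun v : Fin M → Ω => star (u (v i) b) := by
    ext v
    simp [Matrix.sum_apply, Matrix.vecMulVec_apply]
  rw [this]
  refine add_mem (const_mem_momentSubring _ _) (mul_mem (const_mem_momentSubring _ _)
    (Subring.sum_mem _ fun i _ => mul_mem ?_ ?_))
  · exact momentSubring_comp (measurePreserving_eval (fun _ : Fin M => ν) i) (hu a)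
  · exact star_mem_momentSubring
      (momentSubring_comp (measurePreserving_eval (fun _ : Fin M => ν) i) (hu b))

/-- The determinant is affine in u u†, so averaging replaces u_a ū_b by `S a b`. The sum of `S a b`
against the adjugate of the pencil is, by Jacobi's formula, its derivative in `X`. -/
lemma integral_coeff_pencilDet_add_vecMulVec [IsProbabilityMeasure ν] {u : Ω → n → ℂ}
    (hu : ∀ a, (fun x => u x a) ∈ momentSubring ν) {S : Matrix n n ℂ}
    (hS : ∀ a b, ∫ x, u x a * star (u x b) ∂ν = S a b) (B : Matrix n n ℂ) (ρ : ℂ) (j : ℕ) :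
    ∫ x, (pencilDet S (B + ρ • Matrix.vecMulVec (u x) (star (u x)))).coeff j ∂ν =
      (addDeriv ρ (pencilDet S B)).coeff j := by
  have hI : ∀ a b, Integrable (fun x => ρ * (u x a * star (u x b)) *
      ((B.map C + (X : ℂ[X]) • S.map C).adjugate b a).coeff j) ν := fun a b =>
    ((integrable_of_mem_momentSubring (mul_mem (hu a)
      (star_mem_momentSubring (hu b)))).const_mul _).mul_const _
  simp only [pencilDet_add_vecMulVec, coeff_add, finsetSum_coeff, coeff_C_mul, Pi.star_apply]
  rw [addDeriv, coeff_add, coeff_C_mul, pencilDet, derivative_det_add_X_smul,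
    integral_add (integrable_const _)
      (integrable_finsetSum _ fun a _ => integrable_finsetSum _ fun b _ => hI a b),
    integral_finsetSum _ fun a _ => integrable_finsetSum _ fun b _ => hI a b]
  simp only [finsetSum_coeff, coeff_C_mul, Finset.mul_sum]
  congr 1
  · simp
  · refine Finset.sum_congr rfl fun a _ => ?_
    rw [integral_finsetSum _ fun b _ => hI a b]
    refine Finset.sum_congr rfl fun b _ => ?_
    rw [integral_mul_const, integral_const_mul, hS, mul_assoc]

/-- The expected characteristic pencil of a Gram matrix with independent columns. -/
theorem integral_coeff_pencilDet_gram [IsProbabilityMeasure ν] {u : Ω → n → ℂ}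
    (hu : ∀ a, (fun x => u x a) ∈ momentSubring ν) {S : Matrix n n ℂ}
    (hS : ∀ a b, ∫ x, u x a * star (u x b) ∂ν = S a b) (B : Matrix n n ℂ) (ρ : ℂ) (M j : ℕ) :
    ∫ v : Fin M → Ω, (pencilDet S
        (B + ρ • ∑ i, Matrix.vecMulVec (u (v i)) (star (u (v i))))).coeff j
        ∂(Measure.pi fun _ => ν) =
      ((addDeriv ρ)^[M] (pencilDet S B)).coeff j := by
  -- Coefficient `j` of `addDeriv ρ p` involves coefficient `j + 1` of `p`, so all degrees are
  -- needed at once.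
  induction M generalizing j with
  | zero => simp
  | succ M ih =>
    have hmp := (measurePreserving_piFinSuccAbove (fun _ : Fin (M + 1) => ν) 0).symm
    have hint := fun j => hmp.integrable_comp_of_integrable (integrable_of_mem_momentSubring
      (pencilDet_mem_polyMomentSubring (S := S) (gram_mem_momentSubring hu (M + 1) B ρ) j))
    rw [← hmp.integral_comp']
    simp only [Function.comp_def, MeasurableEquiv.piFinSuccAbove_symm_apply, Fin.insertNthEquiv,
      Fin.insertNth_zero, Equiv.coe_fn_mk, Fin.sum_univ_succ, Fin.cons_succ, Fin.cons_zero, cast_eq]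
      at hint ⊢
    rw [integral_prod_symm _ (hint j)]
    have e : ∀ (x : Ω) (y : Fin M → Ω),
        B + ρ • (Matrix.vecMulVec (u x) (star (u x)) +
          ∑ i, Matrix.vecMulVec (u (y i)) (star (u (y i)))) =
        (B + ρ • ∑ i, Matrix.vecMulVec (u (y i)) (star (u (y i)))) +
          ρ • Matrix.vecMulVec (u x) (star (u x)) := fun x y => by
      rw [smul_add]; abel
    -- The new column is averaged with the others frozen. The outcome is linear in the coefficients
    -- of the smaller pencil, so the induction hypothesis applies.
    simp only [e, integral_coeff_pencilDet_add_vecMulVec hu hS, coeff_addDeriv]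
    have hint' := fun j => integrable_of_mem_momentSubring
      (pencilDet_mem_polyMomentSubring (S := S) (gram_mem_momentSubring hu M B ρ) j)
    simp only at hint'
    rw [integral_add (hint' j) (((hint' (j + 1)).mul_const _).const_mul _), integral_const_mul,
      integral_mul_const, ih, ih, Function.iterate_succ_apply', coeff_addDeriv]

end ExpectedDeterminant

/-! ### The Gamma law of the squared norm. -/

section RadialLaw

/-- Polar coordinates and u = r²: the angle contributes 2π, which cancels 1/π and the 2 in du = 2r
dr, leaving the Exp(1) law. -/
lemma lintegral_normSq_stdComplexGaussian (F : ℝ → ENNReal) (hF : Measurable F) :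
    ∫⁻ z, F (‖z‖ ^ 2) ∂stdComplexGaussian =
      ∫⁻ u in Set.Ioi 0, F u * ENNReal.ofReal (Real.exp (-u)) := by
  set G : ℝ → ENNReal := fun u => F u * ENNReal.ofReal (Real.exp (-u)) with hG
  have hGm : Measurable G := by fun_prop
  have himg : (fun r : ℝ => r ^ 2) '' Set.Ioi 0 = Set.Ioi 0 := by
    ext u
    simp only [Set.mem_image, Set.mem_Ioi]
    constructor
    · rintro ⟨r, hr, rfl⟩; positivity
    · intro hu; exact ⟨√u, Real.sqrt_pos.mpr hu, Real.sq_sqrt hu.le⟩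
  have hsub : ∫⁻ u in Set.Ioi 0, G u =
      ∫⁻ r in Set.Ioi (0 : ℝ), ENNReal.ofReal |2 * r| * G (r ^ 2) := by
    rw [← himg, lintegral_image_eq_lintegral_abs_deriv_mul measurableSet_Ioi
      (fun x _ => by simpa using (hasDerivAt_pow 2 x).hasDerivWithinAt), himg]
    intro x hx y hy hxy
    exact (pow_left_inj₀ (le_of_lt hx) (le_of_lt hy) two_ne_zero).mp hxy
  rw [stdComplexGaussian_eq_withDensity,
    lintegral_withDensity_eq_lintegral_mul _ (by fun_prop) (by fun_prop),
    ← Complex.lintegral_comp_polarCoord_symm, hsub, polarCoord_target, Measure.volume_eq_prod,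
    setLIntegral_prod _ (by
      refine Measurable.aemeasurable ?_
      simp only [Pi.mul_apply, Complex.norm_polarCoord_symm]
      fun_prop)]
  refine setLIntegral_congr_fun measurableSet_Ioi fun r hr => ?_
  simp only [Pi.mul_apply, Complex.norm_polarCoord_symm, sq_abs, lintegral_const, hG, smul_eq_mul,
    Measure.restrict_apply_univ, Real.volume_Ioo]
  have h0 : (0 : ℝ) < r := hr
  rw [abs_of_pos (by positivity : (0 : ℝ) < 2 * r)]
  have h1 : ENNReal.ofReal (2 * r) * (F (r ^ 2) * ENNReal.ofReal (Real.exp (-r ^ 2))) =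
      F (r ^ 2) * ENNReal.ofReal (2 * r * Real.exp (-r ^ 2)) := by
    rw [ENNReal.ofReal_mul (p := 2 * r) (by positivity)]; ring
  have h2 : ENNReal.ofReal r * (ENNReal.ofReal (Real.pi⁻¹ * Real.exp (-r ^ 2)) * F (r ^ 2)) *
      ENNReal.ofReal (Real.pi - -Real.pi) =
      F (r ^ 2) * ENNReal.ofReal (r * (Real.pi⁻¹ * Real.exp (-r ^ 2)) * (Real.pi - -Real.pi)) := by
    rw [ENNReal.ofReal_mul (p := r * (Real.pi⁻¹ * Real.exp (-r ^ 2))) (by positivity),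
      ENNReal.ofReal_mul (p := r) h0.le]; ring
  rw [h1, h2]
  congr 2
  field_simp
  ring

/-- Exp(1) convolved with Gamma(n+1) is Gamma(n+2): with w = u + v the exponentials merge into
e^{-w}, and v^n/n! is integrated over (0, w). -/
lemma lintegral_Ioi_conv_exp (n : ℕ) (F : ℝ → ENNReal) (hF : Measurable F) :
    ∫⁻ u in Set.Ioi (0 : ℝ), (∫⁻ v in Set.Ioi (0 : ℝ),
        F (u + v) * ENNReal.ofReal (v ^ n / n.factorial * Real.exp (-v))) *
          ENNReal.ofReal (Real.exp (-u)) =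
      ∫⁻ w in Set.Ioi (0 : ℝ), F w *
        ENNReal.ofReal (w ^ (n + 1) / (n + 1).factorial * Real.exp (-w)) := by
  have hin : ∀ w ∈ Set.Ioi (0 : ℝ), ∫⁻ v in Set.Ioo 0 w, ENNReal.ofReal (v ^ n / n.factorial) =
      ENNReal.ofReal (w ^ (n + 1) / (n + 1).factorial) := by
    intro w hw
    have hw0 : (0 : ℝ) ≤ w := le_of_lt hw
    rw [← ofReal_integral_eq_lintegral_ofReal]
    · rw [← integral_Ioc_eq_integral_Ioo, ← intervalIntegral.integral_of_le hw0,
        intervalIntegral.integral_div, integral_pow, Nat.factorial_succ]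
      congr 1
      push_cast
      field_simp
      simp
    · exact ((by fun_prop : Continuous fun v : ℝ => v ^ n / n.factorial).integrableOn_Icc).mono_set
        Set.Ioo_subset_Icc_self
    · filter_upwards [ae_restrict_mem measurableSet_Ioo] with v hv
      have := hv.1
      positivity
  calc _ = ∫⁻ u in Set.Ioi (0 : ℝ), ∫⁻ v in Set.Ioi (0 : ℝ),
        F (u + v) * ENNReal.ofReal (v ^ n / n.factorial * Real.exp (-v)) *
          ENNReal.ofReal (Real.exp (-u)) := by
        refine lintegral_congr fun u => ?_
        rw [lintegral_mul_const _ (by fun_prop)]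
    _ = ∫⁻ v in Set.Ioi (0 : ℝ), ∫⁻ u in Set.Ioi (0 : ℝ),
        F (u + v) * ENNReal.ofReal (v ^ n / n.factorial * Real.exp (-(u + v))) := by
        rw [lintegral_lintegral_swap (by fun_prop)]
        refine setLIntegral_congr_fun measurableSet_Ioi fun v hv => lintegral_congr fun u => ?_
        have : (0 : ℝ) < v := hv
        rw [mul_assoc, ← ENNReal.ofReal_mul (by positivity), mul_assoc, ← Real.exp_add]
        congr 4; ring
    -- After translation by `v`, the nested indicators encode 0 < v < w, so that Tonelli can be used
    -- on the whole plane.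
    _ = ∫⁻ v, ∫⁻ w, (Set.Ioi (0 : ℝ)).indicator (fun v => (Set.Ioi v).indicator (fun w =>
        F w * ENNReal.ofReal (v ^ n / n.factorial * Real.exp (-w))) w) v := by
        rw [← lintegral_indicator measurableSet_Ioi]
        refine lintegral_congr fun v => ?_
        by_cases hv : v ∈ Set.Ioi (0 : ℝ)
        · simp only [Set.indicator_of_mem hv]
          rw [← lintegral_indicator measurableSet_Ioi, ← lintegral_sub_right_eq_self _ v]
          refine lintegral_congr fun w => ?_
          by_cases hw : v < w
          · rw [Set.indicator_of_mem (by simpa using hw), Set.indicator_of_mem (by simpa using hw)]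
            simp
          · rw [Set.indicator_of_notMem (by simpa using hw),
              Set.indicator_of_notMem (by simpa using hw)]
        · simp only [Set.indicator_of_notMem hv, lintegral_zero]
    _ = ∫⁻ w, ∫⁻ v, (Set.Ioi (0 : ℝ)).indicator (fun v => (Set.Ioi v).indicator (fun w =>
        F w * ENNReal.ofReal (v ^ n / n.factorial * Real.exp (-w))) w) v := by
        rw [lintegral_lintegral_swap]
        refine Measurable.aemeasurable ?_
        have : (Function.uncurry fun v w => (Set.Ioi (0 : ℝ)).indicator (fun v =>
            (Set.Ioi v).indicator (fun w =>
              F w * ENNReal.ofReal (v ^ n / n.factorial * Real.exp (-w))) w) v) =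
            ({p : ℝ × ℝ | 0 < p.1} ∩ {p : ℝ × ℝ | p.1 < p.2}).indicator fun p =>
              F p.2 * ENNReal.ofReal (p.1 ^ n / n.factorial * Real.exp (-p.2)) := by
          ext ⟨v, w⟩
          by_cases h1 : 0 < v <;> by_cases h2 : v < w <;> simp [Set.indicator, h1, h2]
        rw [this]
        exact Measurable.indicator (by fun_prop)
          ((measurableSet_lt measurable_const measurable_fst).inter
            (measurableSet_lt measurable_fst measurable_snd))
    _ = _ := by
        rw [← lintegral_indicator measurableSet_Ioi]
        refine lintegral_congr fun w => ?_
        have hfun : (fun v => (Set.Ioi (0 : ℝ)).indicator (fun v => (Set.Ioi v).indicator (fun w =>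
            F w * ENNReal.ofReal (v ^ n / n.factorial * Real.exp (-w))) w) v) =
            (Set.Ioo 0 w).indicator fun v =>
              (F w * ENNReal.ofReal (Real.exp (-w))) * ENNReal.ofReal (v ^ n / n.factorial) := by
          ext v
          by_cases h1 : 0 < v <;> by_cases h2 : v < w <;> simp [Set.indicator, h1, h2]
          rw [ENNReal.ofReal_mul (by positivity)]
          ring
        rw [hfun, lintegral_indicator measurableSet_Ioo, lintegral_const_mul _ (by fun_prop)]
        by_cases hw : w ∈ Set.Ioi (0 : ℝ)
        · have : (0 : ℝ) < w := hw
          rw [hin w hw, Set.indicator_of_mem hw, mul_assoc, ← ENNReal.ofReal_mul (by positivity),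
            mul_comm (Real.exp _)]
        · rw [Set.indicator_of_notMem hw, Set.Ioo_eq_empty (by simpa using hw)]
          simp

/-- The squared norm of a standard complex Gaussian vector of length `n + 1` is Gamma
distributed with shape `n + 1`. -/
theorem lintegral_frobSq_gaussianVec (n : ℕ) (F : ℝ → ENNReal) (hF : Measurable F) :
    ∫⁻ k, F (frobSq k) ∂(gaussianVec (n + 1)) =
      ∫⁻ r in Set.Ioi (0 : ℝ), F r *
        ENNReal.ofReal (r ^ n / n.factorial * Real.exp (-r)) := by
  induction n generalizing F with
  | zero =>
    have h := (measurePreserving_eval (fun _ : Fin 1 => stdComplexGaussian) 0).lintegral_comp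
      (f := fun z => F (‖z‖ ^ 2)) (by fun_prop)
    simp only [frobSq, Fin.sum_univ_succ, Function.eval] at h ⊢
    simp only [Finset.univ_eq_empty, Finset.sum_empty, add_zero]
    rw [h, lintegral_normSq_stdComplexGaussian F hF]
    simp
  | succ n ih =>
    have hmf := measurable_frobSq (N := n + 1)
    rw [← ((measurePreserving_piFinSuccAbove (fun _ : Fin (n + 2) => stdComplexGaussian)
      0).symm).lintegral_comp_emb (MeasurableEquiv.measurableEmbedding _)]
    have e : ∀ p : ℂ × (Fin (n + 1) → ℂ),
        frobSq ((MeasurableEquiv.piFinSuccAbove (fun _ : Fin (n + 2) => ℂ) 0).symm p) =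
          ‖p.1‖ ^ 2 + frobSq p.2 := by
      intro p
      simp [frobSq, Fin.sum_univ_succ (n := n + 1), MeasurableEquiv.piFinSuccAbove_symm_apply,
        Fin.insertNthEquiv]
    simp only [e]
    rw [lintegral_prod _ (by fun_prop), ← lintegral_Ioi_conv_exp n F hF,
      ← lintegral_normSq_stdComplexGaussian (fun u => ∫⁻ v in Set.Ioi (0 : ℝ),
        F (u + v) * ENNReal.ofReal (v ^ n / n.factorial * Real.exp (-v)))
      (Measurable.lintegral_prod_right' (f := fun p : ℝ × ℝ => F (p.1 + p.2) *
        ENNReal.ofReal (p.2 ^ n / n.factorial * Real.exp (-p.2))) (by fun_prop))]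
    refine lintegral_congr fun z => ?_
    exact ih (fun v => F (‖z‖ ^ 2 + v)) (by fun_prop)

end RadialLaw

/-! ### Truncated series of (1 + ρt)^M e^t and the tail function. -/

section TailSums

/-- The coefficients of the power series `(1 + ρ t) ^ M * exp t`. -/
noncomputable def binomExpCoeff (ρ : ℝ) : ℕ → ℕ → ℝ
  | 0, n => (n.factorial : ℝ)⁻¹
  | _ + 1, 0 => 1
  | M + 1, n + 1 => binomExpCoeff ρ M (n + 1) + ρ * binomExpCoeff ρ M n

lemma binomExpCoeff_zero_right (ρ : ℝ) (M : ℕ) : binomExpCoeff ρ M 0 = 1 := by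
  cases M <;> simp [binomExpCoeff]

lemma binomExpCoeff_nonneg {ρ : ℝ} (hρ : 0 ≤ ρ) (M n : ℕ) : 0 ≤ binomExpCoeff ρ M n := by
  induction M generalizing n with
  | zero => simp only [binomExpCoeff]; positivity
  | succ M ih =>
    cases n with
    | zero => simp [binomExpCoeff]
    | succ n => exact add_nonneg (ih _) (mul_nonneg hρ (ih _))

lemma binomExpCoeff_one (ρ : ℝ) (M : ℕ) : binomExpCoeff ρ M 1 = ρ * M + 1 := by
  induction M with
  | zero => simp [binomExpCoeff]
  | succ M ih => simp only [binomExpCoeff, ih, binomExpCoeff_zero_right]; push_cast; ring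

/-- Compare coefficients of t^(n+1) in (1 + ρt) f' = (ρM + 1 + ρt) f, the equation satisfied by f =
(1 + ρt)^M e^t. -/
lemma binomExpCoeff_recurrence (ρ : ℝ) (M n : ℕ) :
    (n + 2) * binomExpCoeff ρ M (n + 2) + ρ * (n + 1) * binomExpCoeff ρ M (n + 1) =
      (ρ * M + 1) * binomExpCoeff ρ M (n + 1) + ρ * binomExpCoeff ρ M n := by
  induction M generalizing n with
  | zero =>
    simp only [binomExpCoeff, Nat.factorial_succ]
    push_cast
    field_simp
    ring
  | succ M ih =>
    cases n with
    | zero =>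
      have h := ih 0
      simp only [binomExpCoeff, binomExpCoeff_zero_right, binomExpCoeff_one, zero_add] at h ⊢
      push_cast at h ⊢
      linear_combination h
    | succ n =>
      have h := ih (n + 1)
      have h' := ih n
      simp only [binomExpCoeff]
      push_cast at h h' ⊢
      linear_combination h + ρ * h'

open Polynomial in
lemma addDeriv_iterate_linear (ρ : ℂ) (M : ℕ) (a b : ℂ) (p q : ℂ[X]) :
    (addDeriv ρ)^[M] (C a * p + C b * q) =
      C a * (addDeriv ρ)^[M] p + C b * (addDeriv ρ)^[M] q := by
  induction M generalizing p q with
  | zero => rfl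
  | succ M ih =>
    rw [Function.iterate_succ_apply, Function.iterate_succ_apply, Function.iterate_succ_apply, ← ih]
    congr 1
    simp only [addDeriv, derivative_add, derivative_C_mul]
    ring

open Polynomial in
-- Applying 1 + ρ d/dX to (1+X)^(n+1) yields (1+X)^(n+1) + ρ(n+1)(1+X)^n, which after dividing by
-- (n+1)! is the recursion defining `binomExpCoeff`.
lemma coeff_zero_addDeriv_iterate (ρ : ℝ) (M n : ℕ) :
    ((addDeriv (ρ : ℂ))^[M] ((1 + X) ^ n)).coeff 0 =
      ((n.factorial * binomExpCoeff ρ M n : ℝ) : ℂ) := by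
  induction M generalizing n with
  | zero =>
    have : (n.factorial : ℝ) * binomExpCoeff ρ 0 n = 1 := by
      simp only [binomExpCoeff]; field_simp
    rw [this]
    simp [coeff_zero_eq_eval_zero]
  | succ M ih =>
    cases n with
    | zero =>
      have h : addDeriv (ρ : ℂ) ((1 + X) ^ 0) = (1 + X) ^ 0 := by simp [addDeriv]
      rw [Function.iterate_succ_apply, h, ih, binomExpCoeff_zero_right, binomExpCoeff_zero_right]
    | succ n =>
      have h : addDeriv (ρ : ℂ) ((1 + X) ^ (n + 1)) =
          C (1 : ℂ) * (1 + X) ^ (n + 1) + C ((ρ : ℂ) * (n + 1)) * (1 + X) ^ n := by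
        simp only [addDeriv, derivative_pow, derivative_add, derivative_one, derivative_X, C_mul,
          C_add, C_1]
        simp
        ring
      rw [Function.iterate_succ_apply, h, addDeriv_iterate_linear, coeff_add, coeff_C_mul,
        coeff_C_mul, ih, ih, binomExpCoeff, Nat.factorial_succ]
      push_cast
      ring

/-- The truncation of the power series `(1 + ρ t) ^ M * exp t` to degree less than `N`. -/
noncomputable def truncSum (ρ : ℝ) (M N : ℕ) (x : ℝ) : ℝ :=
  ∑ n ∈ Finset.range N, binomExpCoeff ρ M n * x ^ n

lemma truncSum_nonneg {ρ : ℝ} (hρ : 0 ≤ ρ) (M N : ℕ) {x : ℝ} (hx : 0 ≤ x) : 0 ≤ truncSum ρ M N x :=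
  Finset.sum_nonneg fun n _ => mul_nonneg (binomExpCoeff_nonneg hρ M n) (pow_nonneg hx n)

/-- The full series f satisfies (1 + ρx)(f' - f) = Mρ f. After truncation the recurrence still
cancels every degree below `n`, and only the boundary terms of degrees `n` and `n + 1` survive. -/
lemma exists_hasDerivAt_truncSum (ρ : ℝ) (M n : ℕ) (x : ℝ) :
    ∃ d, HasDerivAt (truncSum ρ M (n + 1)) d x ∧
      (1 + ρ * x) * (d - truncSum ρ M (n + 1) x) - M * ρ * truncSum ρ M (n + 1) x =
        -(x ^ n * ((n + 1) * binomExpCoeff ρ M (n + 1) + ρ * x * binomExpCoeff ρ M n)) := by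
  induction n with
  | zero =>
    refine ⟨0, ?_, ?_⟩
    · have : truncSum ρ M 1 = fun _ => 1 := by
        ext x; simp [truncSum, binomExpCoeff_zero_right]
      simpa [this] using hasDerivAt_const x (1 : ℝ)
    · simp only [truncSum, Finset.sum_range_succ, Finset.sum_range_zero, binomExpCoeff_zero_right,
        binomExpCoeff_one, zero_add]
      push_cast
      ring
  | succ n ih =>
    obtain ⟨d, hd, he⟩ := ih
    have hs : ∀ x, truncSum ρ M (n + 1 + 1) x =
        truncSum ρ M (n + 1) x + binomExpCoeff ρ M (n + 1) * x ^ (n + 1) := fun x => by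
      rw [truncSum, Finset.sum_range_succ]; rfl
    refine ⟨d + binomExpCoeff ρ M (n + 1) * ((n + 1 : ℕ) * x ^ n), ?_, ?_⟩
    · have := hd.add ((hasDerivAt_pow (n + 1) x).const_mul (binomExpCoeff ρ M (n + 1)))
      rw [Nat.add_sub_cancel] at this
      exact this.congr_of_eventuallyEq (Filter.Eventually.of_forall hs)
    · rw [hs]
      have hr := binomExpCoeff_recurrence ρ M n
      push_cast
      linear_combination he + x ^ (n + 1) * hr

/-- The tail function of the output signal-to-noise ratio. -/
noncomputable def tailFun (ρ : ℝ) (M N : ℕ) (x : ℝ) : ℝ :=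
  Real.exp (-x) * (truncSum ρ M N x / (1 + ρ * x) ^ M)

/-- The mixture of Gamma densities whose tail is `tailFun ρ M (n + 1)`. -/
noncomputable def tailDensity (ρ : ℝ) (M n : ℕ) (x : ℝ) : ℝ :=
  x ^ n * Real.exp (-x) *
    (((n + 1) * binomExpCoeff ρ M (n + 1) + ρ * x * binomExpCoeff ρ M n) / (1 + ρ * x) ^ (M + 1))

lemma tailDensity_nonneg {ρ : ℝ} (hρ : 0 ≤ ρ) (M n : ℕ) {x : ℝ} (hx : 0 ≤ x) :
    0 ≤ tailDensity ρ M n x := by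
  have h1 := binomExpCoeff_nonneg hρ M n
  have h2 := binomExpCoeff_nonneg hρ M (n + 1)
  unfold tailDensity
  positivity

lemma tailFun_nonneg {ρ : ℝ} (hρ : 0 ≤ ρ) (M n : ℕ) {x : ℝ} (hx : 0 ≤ x) :
    0 ≤ tailFun ρ M n x := by
  have h1 := truncSum_nonneg hρ M n hx
  unfold tailFun
  positivity

/-- Differentiation puts e^{-x}/(1 + ρx)^(M+1) in front of exactly the defect computed in
`exists_hasDerivAt_truncSum`. -/
lemma hasDerivAt_tailFun {ρ : ℝ} (hρ : 0 ≤ ρ) (M n : ℕ) {x : ℝ} (hx : 0 ≤ x) :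
    HasDerivAt (tailFun ρ M (n + 1)) (-tailDensity ρ M n x) x := by
  obtain ⟨d, hd, he⟩ := exists_hasDerivAt_truncSum ρ M n x
  have hp : 0 < 1 + ρ * x := by positivity
  have hden : HasDerivAt (fun x => (1 + ρ * x) ^ M) (M * (1 + ρ * x) ^ (M - 1) * ρ) x := by
    have := (((hasDerivAt_id x).const_mul ρ).const_add 1).fun_pow M
    simpa using this
  have hexp : HasDerivAt (fun x : ℝ => Real.exp (-x)) (-Real.exp (-x)) x := by
    simpa using (hasDerivAt_neg x).exp
  have := hexp.mul (hd.div hden (pow_ne_zero M hp.ne'))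
  refine this.congr_deriv ?_
  have hM : (M : ℝ) * (1 + ρ * x) ^ (M - 1) * (1 + ρ * x) = M * (1 + ρ * x) ^ M := by
    cases M with
    | zero => simp
    | succ M => rw [Nat.add_sub_cancel]; ring
  have hq : (M : ℝ) * (1 + ρ * x) ^ (M - 1) = M * (1 + ρ * x) ^ M / (1 + ρ * x) := by
    rw [eq_div_iff hp.ne', hM]
  rw [hq, tailDensity, Pi.div_apply, pow_succ (1 + ρ * x) M]
  have hD : (1 + ρ * x) ^ M ≠ 0 := pow_ne_zero M hp.ne'
  have hp' := hp.ne'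
  generalize (1 + ρ * x) ^ M = D at hD ⊢
  generalize 1 + ρ * x = p at hp' he ⊢
  have h1 : -Real.exp (-x) * (truncSum ρ M (n + 1) x / D) + Real.exp (-x) *
      ((d * D - truncSum ρ M (n + 1) x * (M * D / p * ρ)) / D ^ 2) = Real.exp (-x) / (D * p) *
      (p * (d - truncSum ρ M (n + 1) x) - M * ρ * truncSum ρ M (n + 1) x) := by
    field_simp
    ring
  rw [h1, he]
  ring

lemma tendsto_tailFun {ρ : ℝ} (hρ : 0 ≤ ρ) (M N : ℕ) :
    Filter.Tendsto (tailFun ρ M N) Filter.atTop (nhds 0) := by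
  have h1 : Filter.Tendsto (fun x => Real.exp (-x) * truncSum ρ M N x) Filter.atTop (nhds 0) := by
    simp only [truncSum, Finset.mul_sum]
    rw [← Finset.sum_const_zero (s := Finset.range N)]
    refine tendsto_finsetSum _ fun n _ => ?_
    have := (Real.tendsto_pow_mul_exp_neg_atTop_nhds_zero n).const_mul (binomExpCoeff ρ M n)
    rw [mul_zero] at this
    refine this.congr fun x => by ring
  refine squeeze_zero' ?_ ?_ h1
  · filter_upwards [Filter.eventually_ge_atTop 0] with x hx using tailFun_nonneg hρ M N hx
  · filter_upwards [Filter.eventually_ge_atTop 0] with x hx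
    have : 1 ≤ (1 + ρ * x) ^ M := one_le_pow₀ (by nlinarith [mul_nonneg hρ hx])
    exact mul_le_mul_of_nonneg_left (div_le_self (truncSum_nonneg hρ M N hx) this)
      (Real.exp_pos _).le

lemma integral_tailDensity {ρ : ℝ} (hρ : 0 ≤ ρ) (M n : ℕ) {x : ℝ} (hx : 0 ≤ x) :
    IntegrableOn (tailDensity ρ M n) (Set.Ioi x) ∧
      ∫ r in Set.Ioi x, tailDensity ρ M n r = tailFun ρ M (n + 1) x := by
  have hd : ∀ y ∈ Set.Ici x, HasDerivAt (tailFun ρ M (n + 1)) (-tailDensity ρ M n y) y :=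
    fun y hy => hasDerivAt_tailFun hρ M n (hx.trans hy)
  have hn : ∀ y ∈ Set.Ioi x, -tailDensity ρ M n y ≤ 0 :=
    fun y hy => neg_nonpos.mpr (tailDensity_nonneg hρ M n (hx.trans (le_of_lt hy)))
  have ht := tendsto_tailFun hρ M (n + 1)
  have hi := integrableOn_Ioi_deriv_of_nonpos' hd hn ht
  have he := integral_Ioi_of_hasDerivAt_of_nonpos' hd hn ht
  rw [integral_neg] at he
  exact ⟨by simpa using hi.neg, by linarith⟩

lemma lintegral_tailDensity {ρ : ℝ} (hρ : 0 ≤ ρ) (M n : ℕ) {x : ℝ} (hx : 0 ≤ x) :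
    ∫⁻ r in Set.Ioi x, ENNReal.ofReal (tailDensity ρ M n r) =
      ENNReal.ofReal (tailFun ρ M (n + 1) x) := by
  obtain ⟨hi, he⟩ := integral_tailDensity hρ M n hx
  rw [← he, ofReal_integral_eq_lintegral_ofReal hi]
  filter_upwards [ae_restrict_mem measurableSet_Ioi] with r hr
  exact tailDensity_nonneg hρ M n (hx.trans (le_of_lt hr))

/-- At ρ = 0, M = 0 the tail function becomes that of the Gamma law, so the same results serve the
incomplete gamma function and |h₂|². -/
lemma tailDensity_zero_zero (n : ℕ) (x : ℝ) :
    tailDensity 0 0 n x = x ^ n / n.factorial * Real.exp (-x) := by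
  simp only [tailDensity, binomExpCoeff, Nat.factorial_succ]
  push_cast
  field_simp

lemma upperIncompleteGamma_div_Gamma (n : ℕ) {x : ℝ} (hx : 0 ≤ x) :
    upperIncompleteGamma (n + 1 : ℕ) x / Real.Gamma (n + 1 : ℕ) = tailFun 0 0 (n + 1) x := by
  rw [← (integral_tailDensity le_rfl 0 n hx).2, upperIncompleteGamma, ← integral_div]
  push_cast
  rw [Real.Gamma_nat_eq_factorial]
  refine setIntegral_congr_fun measurableSet_Ioi fun t _ => ?_
  simp only [tailDensity_zero_zero, add_sub_cancel_right, Real.rpow_natCast]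
  ring

/-- The partial sums of the binomial expansion of `(1 + y) ^ M`. -/
def binomPartial (M K : ℕ) (y : ℝ) : ℝ := ∑ i ∈ Finset.range K, (M.choose i : ℝ) * y ^ i

lemma binomPartial_succ_succ (M K : ℕ) (y : ℝ) :
    binomPartial (M + 1) (K + 1) y = binomPartial M (K + 1) y + y * binomPartial M K y := by
  simp only [binomPartial]
  rw [Finset.sum_range_succ', Finset.sum_range_succ' _ K, Finset.mul_sum, add_right_comm,
    ← Finset.sum_add_distrib]
  congr 1
  · refine Finset.sum_congr rfl fun i _ => ?_
    rw [Nat.choose_succ_succ]; push_cast; ring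
  · simp

lemma binomPartial_zero_succ (K : ℕ) (y : ℝ) : binomPartial 0 (K + 1) y = 1 := by
  simp [binomPartial, Finset.sum_range_succ']

lemma binomPartial_eq_pow {M K : ℕ} (h : M < K) (y : ℝ) : binomPartial M K y = (1 + y) ^ M := by
  rw [binomPartial, add_comm 1 y, add_pow, eq_comm]
  refine (Finset.sum_congr rfl fun i _ => ?_).trans
    (Finset.sum_subset (Finset.range_mono h) fun i _ hi => ?_)
  · ring
  · rw [Nat.choose_eq_zero_of_lt (by simpa using hi)]; simp

lemma truncSum_succ_succ (ρ : ℝ) (M N : ℕ) (x : ℝ) :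
    truncSum ρ (M + 1) (N + 1) x = truncSum ρ M (N + 1) x + ρ * x * truncSum ρ M N x := by
  simp only [truncSum]
  rw [Finset.sum_range_succ', Finset.sum_range_succ' _ N, Finset.mul_sum, add_right_comm,
    ← Finset.sum_add_distrib]
  congr 1
  · refine Finset.sum_congr rfl fun i _ => ?_
    simp only [binomExpCoeff]; ring
  · simp [binomExpCoeff_zero_right]

/-- Cauchy product of e^x and (1 + ρx)^M, kept to total degree below `N`; both sides obey the same
Pascal-type recursion in `M`. -/
lemma truncSum_eq_sum_binomPartial (ρ : ℝ) (M N : ℕ) (x : ℝ) :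
    truncSum ρ M N x =
      ∑ m ∈ Finset.range N, x ^ m / m.factorial * binomPartial M (N - m) (ρ * x) := by
  induction M generalizing N with
  | zero =>
    refine Finset.sum_congr rfl fun m hm => ?_
    obtain ⟨k, hk⟩ := Nat.exists_eq_add_of_lt (Finset.mem_range.mp hm)
    rw [show N - m = k + 1 by omega, binomPartial_zero_succ]
    simp only [binomExpCoeff]; ring
  | succ M ih =>
    cases N with
    | zero => simp [truncSum]
    | succ N =>
      rw [truncSum_succ_succ, ih, ih, Finset.mul_sum]
      -- The added term m = N is zero, since `binomPartial M 0` is an empty sum.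
      have h0 : ∑ m ∈ Finset.range N, ρ * x * (x ^ m / m.factorial *
          binomPartial M (N - m) (ρ * x)) =
          ∑ m ∈ Finset.range (N + 1), ρ * x * (x ^ m / m.factorial *
            binomPartial M (N - m) (ρ * x)) := by
        rw [Finset.sum_range_succ]; simp [binomPartial]
      rw [h0, ← Finset.sum_add_distrib]
      refine Finset.sum_congr rfl fun m hm => ?_
      have hm' : m ≤ N := Nat.lt_succ_iff.mp (Finset.mem_range.mp hm)
      rw [show N + 1 - m = N - m + 1 by omega, binomPartial_succ_succ]
      ring

end TailSums

/-! ### Evaluation of ₂F₁ and of the closed form. -/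

section Hypergeometric

/-- (1+y)^M solves (1+y) f' = M f; truncation leaves a defect only in the top degree. -/
lemma exists_hasDerivAt_binomPartial (M s : ℕ) (y : ℝ) :
    ∃ d, HasDerivAt (binomPartial M (s + 1)) d y ∧
      (1 + y) * d - M * binomPartial M (s + 1) y = -((s + 1) * M.choose (s + 1) * y ^ s) := by
  induction s with
  | zero =>
    have h : binomPartial M 1 = fun _ => 1 := by ext y; simp [binomPartial]
    exact ⟨0, by simpa [h] using hasDerivAt_const y (1 : ℝ), by simp [h]⟩
  | succ s ih =>
    obtain ⟨d, hd, he⟩ := ih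
    have hs : ∀ y, binomPartial M (s + 1 + 1) y =
        binomPartial M (s + 1) y + M.choose (s + 1) * y ^ (s + 1) := fun y => by
      rw [binomPartial, Finset.sum_range_succ]; rfl
    refine ⟨d + M.choose (s + 1) * ((s + 1 : ℕ) * y ^ s), ?_, ?_⟩
    · have := hd.add ((hasDerivAt_pow (s + 1) y).const_mul (M.choose (s + 1) : ℝ))
      rw [Nat.add_sub_cancel] at this
      exact this.congr_of_eventuallyEq (Filter.Eventually.of_forall hs)
    · rw [hs]
      have hc : ((s : ℝ) + 2) * M.choose (s + 2) = (M - (s + 1)) * M.choose (s + 1) := by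
        rcases le_or_gt (s + 1) M with h | h
        · have := Nat.choose_succ_right_eq M (s + 1)
          have h2 := congrArg (Nat.cast : ℕ → ℝ) this
          push_cast [Nat.cast_sub h] at h2
          linarith
        · rw [Nat.choose_eq_zero_of_lt h, Nat.choose_eq_zero_of_lt (by omega)]; simp
      push_cast
      linear_combination he + y ^ (s + 1) * hc

/-- A rational expression for `₂F₁(M + 1, s + 1; s + 2; x)`. -/
noncomputable def hypergeometricRational (M s : ℕ) (x : ℝ) : ℝ :=
  (∑ k ∈ Finset.range (M - s), (M.choose (s + 1 + k) : ℝ) / M.choose (s + 1) * (-x) ^ k) /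
    (1 - x) ^ M

/-- The numerator of `hypergeometricRational` is the tail of the expansion of (1 - x)^M divided by
its lowest term; the missing head is `binomPartial`. -/
lemma pow_mul_hypergeometricRational {M s : ℕ} (hs : s < M) {x : ℝ} (hx : x < 1) :
    M.choose (s + 1) * (-x) ^ (s + 1) * hypergeometricRational M s x =
      1 - binomPartial M (s + 1) (-x) / (1 - x) ^ M := by
  have hp : (1 - x) ^ M ≠ 0 := pow_ne_zero _ (by linarith)
  have hc : (M.choose (s + 1) : ℝ) ≠ 0 := by
    exact_mod_cast (Nat.choose_pos (by omega)).ne'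
  have htot := binomPartial_eq_pow (Nat.lt_succ_self M) (-x)
  rw [binomPartial, show M.succ = (s + 1) + (M - s) by omega, Finset.sum_range_add,
    ← sub_eq_add_neg] at htot
  rw [hypergeometricRational, mul_div_assoc', eq_sub_iff_add_eq, ← add_div, div_eq_one_iff_eq hp,
    ← htot, add_comm, binomPartial, Finset.mul_sum]
  congr 1
  refine Finset.sum_congr rfl fun k _ => ?_
  rw [pow_add (-x) (s + 1) k]
  field_simp

lemma hasDerivAt_one_sub_binomPartial_div (M s : ℕ) {x : ℝ} (hx : x < 1) :
    HasDerivAt (fun x => 1 - binomPartial M (s + 1) (-x) / (1 - x) ^ M)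
      (-((s + 1) * M.choose (s + 1) * (-x) ^ s / (1 - x) ^ (M + 1))) x := by
  obtain ⟨d, hd, he⟩ := exists_hasDerivAt_binomPartial M s (-x)
  have hp : 1 - x ≠ 0 := by linarith
  have hD : (1 - x) ^ M ≠ 0 := pow_ne_zero _ hp
  have h1 : HasDerivAt (fun x => binomPartial M (s + 1) (-x)) (-d) x :=
    (hd.comp x (hasDerivAt_neg x)).congr_deriv (by ring)
  have h2 : HasDerivAt (fun x : ℝ => (1 - x) ^ M) (M * (1 - x) ^ (M - 1) * -1) x := by
    simpa using ((hasDerivAt_id x).const_sub 1).fun_pow M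
  refine ((h1.fun_div h2 hD).const_sub 1).congr_deriv ?_
  have hq : (M : ℝ) * (1 - x) ^ (M - 1) = M * (1 - x) ^ M / (1 - x) := by
    rw [eq_div_iff hp]
    cases M with
    | zero => simp
    | succ M => rw [Nat.add_sub_cancel]; ring
  rw [hq, pow_succ (1 - x) M]
  rw [← sub_eq_add_neg] at he
  generalize (1 - x) ^ M = D at hD ⊢
  generalize 1 - x = p at hp he ⊢
  have h3 : -((-d * D - binomPartial M (s + 1) (-x) * (M * D / p * -1)) / D ^ 2) =
      (p * d - M * binomPartial M (s + 1) (-x)) / (D * p) := by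
    field_simp
    ring
  rw [h3, he]
  ring

/-- The ratio (s+1)_n / (s+2)_n telescopes to (s+1)/(n+s+1), and (M+1)_n / n! is a binomial
coefficient. -/
lemma hypergeometric_coeff (M s n : ℕ) :
    ((n.factorial : ℝ)⁻¹ * (ascPochhammer ℝ n).eval ((M : ℝ) + 1) *
      (ascPochhammer ℝ n).eval ((s : ℝ) + 1) * ((ascPochhammer ℝ n).eval ((s : ℝ) + 2))⁻¹) *
        (n + s + 1) = (s + 1) * (n + M).choose M := by
  have h1 : (ascPochhammer ℝ n).eval ((M : ℝ) + 1) = n.factorial * (n + M).choose M := by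
    rw [show (M : ℝ) + 1 = ((M + 1 : ℕ) : ℝ) by push_cast; ring,
      ascPochhammer_nat_eq_natCast_ascFactorial, Nat.ascFactorial_eq_factorial_mul_choose,
      Nat.add_comm n M, ← Nat.choose_symm_add]
    push_cast; ring
  have h2 : ∀ n : ℕ, (ascPochhammer ℝ n).eval ((s : ℝ) + 1) * (n + s + 1) =
      (s + 1) * (ascPochhammer ℝ n).eval ((s : ℝ) + 2) := by
    intro n
    induction n with
    | zero => simp
    | succ n ih =>
      rw [ascPochhammer_succ_eval, ascPochhammer_succ_eval]
      push_cast
      linear_combination ((s : ℝ) + 2 + n) * ih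
  have h3 : (ascPochhammer ℝ n).eval ((s : ℝ) + 2) ≠ 0 :=
    (ascPochhammer_pos n _ (by positivity)).ne'
  have h4 : (n.factorial : ℝ) ≠ 0 := by positivity
  rw [h1]
  field_simp
  linear_combination (((n + M).choose M : ℝ)) * h2 n

/-- The factor x^(s+1) makes termwise differentiation cancel n+s+1, leaving the series of (1 -
x)^(-(M+1)). -/
lemma hasDerivAt_pow_mul_ordinaryHypergeometric (M s : ℕ) {x : ℝ} (hx : x ∈ Set.Ioo (-1 : ℝ) 1) :
    HasDerivAt (fun x : ℝ => x ^ (s + 1) * ordinaryHypergeometric ((M : ℝ) + 1) (s + 1) (s + 2) x)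
      ((s + 1) * x ^ s / (1 - x) ^ (M + 1)) x := by
  obtain ⟨r, hxr, hr1⟩ := exists_between (abs_lt.mpr hx)
  have hr0 : 0 < r := (abs_nonneg x).trans_lt hxr
  obtain ⟨c, hc⟩ : ∃ c : ℕ → ℝ, ∀ n, c n =
      (n.factorial : ℝ)⁻¹ * (ascPochhammer ℝ n).eval ((M : ℝ) + 1) *
        (ascPochhammer ℝ n).eval ((s : ℝ) + 1) * ((ascPochhammer ℝ n).eval ((s : ℝ) + 2))⁻¹ :=
    ⟨_, fun _ => rfl⟩
  have hfun : (fun x : ℝ => x ^ (s + 1) *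
      ordinaryHypergeometric ((M : ℝ) + 1) (s + 1) (s + 2) x) =
      fun x => ∑' n, c n * x ^ (n + s + 1) := by
    ext x
    rw [ordinaryHypergeometric_eq_tsum, ← tsum_mul_left]
    refine tsum_congr fun n => ?_
    simp only [hc, smul_eq_mul]
    ring
  have hr : ‖r‖ < 1 := by rwa [Real.norm_eq_abs, abs_of_pos hr0]
  have hgeom := summable_choose_mul_geometric_of_norm_lt_one M hr
  have hsum := hgeom.mul_left (((s : ℝ) + 1) * r ^ s)
  have hg : ∀ (n : ℕ) (y : ℝ), HasDerivAt (fun x => c n * x ^ (n + s + 1))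
      ((s + 1) * y ^ s * ((n + M).choose M * y ^ n)) y := by
    intro n y
    refine ((hasDerivAt_pow (n + s + 1) y).const_mul (c n)).congr_deriv ?_
    have := hypergeometric_coeff M s n
    rw [← hc] at this
    rw [Nat.add_sub_cancel, pow_add]
    push_cast
    linear_combination y ^ n * y ^ s * this
  have hb : ∀ (n : ℕ) (y : ℝ), y ∈ Set.Ioo (-r) r →
      ‖(s + 1) * y ^ s * ((n + M).choose M * y ^ n)‖ ≤
        (s + 1) * r ^ s * ((n + M).choose M * r ^ n) := by
    intro n y hy
    have hy' : |y| ≤ r := (abs_lt.mpr hy).le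
    have hc0 : (0 : ℝ) ≤ ((n + M).choose M : ℕ) := Nat.cast_nonneg _
    have hs0 : (0 : ℝ) ≤ s + 1 := by positivity
    rw [Real.norm_eq_abs, abs_mul, abs_mul, abs_mul, abs_pow, abs_pow, abs_of_nonneg hs0,
      abs_of_nonneg hc0]
    gcongr
  have h0 : Summable fun n => c n * (0 : ℝ) ^ (n + s + 1) := by
    simp only [pow_succ, mul_zero, summable_zero]
  have hd := hasDerivAt_tsum_of_isPreconnected hsum (isOpen_Ioo (a := -r) (b := r))
    isPreconnected_Ioo (fun n y _ => hg n y) hb (y₀ := 0) ⟨neg_lt_zero.mpr hr0, hr0⟩ h0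
    (abs_lt.mp hxr)
  rw [hfun]
  refine hd.congr_deriv ?_
  rw [tsum_mul_left, tsum_choose_mul_geometric_of_norm_lt_one M
    (by rw [Real.norm_eq_abs]; exact hxr.trans hr1)]
  ring

/-- Multiplied by the same multiple of x^(s+1), both functions have equal derivatives and vanish at
0. Dividing back needs s < M, so that the binomial coefficient is nonzero, and x ≠ 0; at 0 both
values are 1. -/
lemma isHypergeometricContinuation_rational {M s : ℕ} (hs : s < M) :
    IsHypergeometricContinuation ((M : ℝ) + 1) (s + 1) (s + 2) (hypergeometricRational M s) := by
  constructor
  · intro x hx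
    have hx' : 1 - x ≠ 0 := by have : x < 1 := hx; linarith
    unfold hypergeometricRational
    fun_prop (disch := exact pow_ne_zero _ hx')
  · have hc : (M.choose (s + 1) : ℝ) ≠ 0 := by
      exact_mod_cast (Nat.choose_pos (by omega)).ne'
    have hEq : Set.EqOn
        (fun x : ℝ => (M.choose (s + 1) * (-1) ^ (s + 1)) * (x ^ (s + 1) *
          ordinaryHypergeometric ((M : ℝ) + 1) (s + 1) (s + 2) x))
        (fun x => 1 - binomPartial M (s + 1) (-x) / (1 - x) ^ M) (Set.Ioo (-1) 1) := by
      refine isOpen_Ioo.eqOn_of_deriv_eq isPreconnected_Ioo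
        (fun x hx => ((hasDerivAt_pow_mul_ordinaryHypergeometric M s hx).const_mul
          _).differentiableAt.differentiableWithinAt)
        (fun x hx => (hasDerivAt_one_sub_binomPartial_div M s
          hx.2).differentiableAt.differentiableWithinAt) ?_
        (x := 0) (by norm_num) (by simp [binomPartial, Finset.sum_range_succ'])
      intro x hx
      rw [((hasDerivAt_pow_mul_ordinaryHypergeometric M s hx).const_mul _).deriv,
        (hasDerivAt_one_sub_binomPartial_div M s hx.2).deriv, neg_pow x s]
      ring
    intro x hx
    rcases eq_or_ne x 0 with rfl | hx0
    · rw [ordinaryHypergeometric_zero, hypergeometricRational,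
        show M - s = (M - s - 1) + 1 by omega, Finset.sum_range_succ']
      simp [hc]
    · have h1 := hEq hx
      have h2 := pow_mul_hypergeometricRational hs hx.2
      simp only at h1
      rw [← h1, neg_pow] at h2
      have h3 : (M.choose (s + 1) : ℝ) * ((-1) ^ (s + 1) * x ^ (s + 1)) ≠ 0 :=
        mul_ne_zero hc (mul_ne_zero (by simp) (pow_ne_zero _ hx0))
      refine mul_left_cancel₀ h3 (h2.trans ?_)
      ring

/-- By the identity theorem on the connected half-line, the arbitrary choice in the definition is
harmless. -/
lemma gaussHypergeometric_eq_of_continuation {a b c : ℝ} {F : ℝ → ℝ}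
    (hF : IsHypergeometricContinuation a b c F) {x : ℝ} (hx : x < 1) :
    gaussHypergeometric a b c x = F x := by
  have hex : ∃ F, IsHypergeometricContinuation a b c F := ⟨F, hF⟩
  rw [gaussHypergeometric, dif_pos hex]
  have hG := hex.choose_spec
  refine hG.1.eqOn_of_preconnected_of_eventuallyEq hF.1 isPreconnected_Iio
    (z₀ := 0) (by simp) ?_ hx
  filter_upwards [isOpen_Ioo.mem_nhds (show (0 : ℝ) ∈ Set.Ioo (-1) 1 by norm_num)] with y hy
  rw [hG.2 hy, hF.2 hy]

lemma choose_mul_pow_mul_gaussHypergeometric {M s : ℕ} (hs : s < M) {y : ℝ} (hy : 0 ≤ y) :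
    M.choose (s + 1) * y ^ (s + 1) * gaussHypergeometric ((M : ℝ) + 1) (s + 1) (s + 2) (-y) =
      1 - binomPartial M (s + 1) y / (1 + y) ^ M := by
  have h := pow_mul_hypergeometricRational hs (x := -y) (by linarith)
  rw [gaussHypergeometric_eq_of_continuation (isHypergeometricContinuation_rational hs)
    (by linarith)]
  simpa using h

/-- After shifting `m` by one, the Gamma factors form (1/m!) · C(M, N-m), and each ₂F₁ is evaluated.
The right side may start at 0 because for m < N - M the partial sum is already all of (1+y)^M; this
is the origin of m₁. -/
lemma sum_hypergeometric_eq (N M : ℕ) {ρ₁ ρI z : ℝ} (hρ₁ : 0 < ρ₁) (hρI : 0 < ρI) (hz : 0 ≤ z) :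
    Real.Gamma (M + 1) * Real.exp (-(z / ρ₁)) * (z / ρ₁) ^ N *
      ∑ m ∈ Finset.Icc (N - M + 1) N,
        ρI ^ (N - m + 1) *
          gaussHypergeometric (M + 1) ((N : ℝ) - m + 1) ((N : ℝ) - m + 2) (-(ρI / ρ₁ * z)) /
          (Real.Gamma m * Real.Gamma ((N : ℝ) - m + 2) * Real.Gamma ((m : ℝ) - N + M)) =
      Real.exp (-(z / ρ₁)) * ∑ m ∈ Finset.range N, (z / ρ₁) ^ m / m.factorial *
        (1 - binomPartial M (N - m) (ρI * (z / ρ₁)) / (1 + ρI * (z / ρ₁)) ^ M) := by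
  set x := z / ρ₁ with hx
  have hx0 : 0 ≤ x := by positivity
  have hy0 : 0 ≤ ρI * x := by positivity
  have hy : ρI / ρ₁ * z = ρI * x := by rw [hx]; ring
  have hIcc : Finset.Icc (N - M + 1) N = (Finset.Ico (N - M) N).map (addRightEmbedding 1) := by
    rw [Finset.map_add_right_Ico]
    ext m; simp only [Finset.mem_Icc, Finset.mem_Ico]; omega
  rw [hy, hIcc, Finset.sum_map, mul_comm (Real.Gamma _), mul_assoc, mul_assoc]
  congr 1
  rw [Finset.mul_sum, Finset.mul_sum, Finset.range_eq_Ico]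
  refine (Finset.sum_congr rfl fun m hm => ?_).trans
    (Finset.sum_subset (Finset.Ico_subset_Ico_left (Nat.zero_le (N - M))) fun m hm hm' => ?_)
  · obtain ⟨h1, h2⟩ := Finset.mem_Ico.mp hm
    obtain ⟨s, hs⟩ := Nat.exists_eq_add_of_lt h2
    have hsM : s < M := by omega
    simp only [addRightEmbedding_apply]
    rw [show N - m = s + 1 by omega, show N - (m + 1) + 1 = s + 1 by omega,
      ← choose_mul_pow_mul_gaussHypergeometric hsM hy0]
    obtain ⟨t, rfl⟩ := Nat.exists_eq_add_of_lt hsM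
    subst hs
    push_cast
    rw [show (m : ℝ) + s + 1 - (m + 1) + 1 = s + 1 by ring,
      show (m : ℝ) + s + 1 - (m + 1) + 2 = s + 2 by ring,
      show (m : ℝ) + 1 - (m + s + 1) + (s + t + 1) = t + 1 by ring,
      show (s : ℝ) + t + 1 + 1 = ((s + t + 1 : ℕ) : ℝ) + 1 by push_cast; ring,
      Real.Gamma_nat_eq_factorial, Real.Gamma_nat_eq_factorial, Real.Gamma_nat_eq_factorial,
      show Real.Gamma ((s : ℝ) + 2) = (s + 1).factorial by
        rw [← Real.Gamma_nat_eq_factorial]; congr 1; push_cast; ring]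
    have hch : ((s + t + 1).choose (s + 1) : ℝ) =
        (s + t + 1).factorial / ((s + 1).factorial * t.factorial) := by
      rw [Nat.cast_choose ℝ (by omega), show s + t + 1 - (s + 1) = t by omega]
    rw [hch, mul_pow, show m + s + 1 = m + (s + 1) by ring, pow_add x m]
    push_cast
    generalize gaussHypergeometric _ _ _ _ = G
    field_simp
  · have h2 := (Finset.mem_Ico.mp hm).2
    have h1 : m < N - M := by
      by_contra h; exact hm' (Finset.mem_Ico.mpr ⟨by omega, h2⟩)
    rw [binomPartial_eq_pow (by omega), div_self (by positivity), sub_self, mul_zero]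

/-- The incomplete gamma quotient is e^{-x} ∑ x^m/m!, which cancels the 1 in every summand of
`sum_hypergeometric_eq`. -/
theorem mmseCdf_eq (N M : ℕ) (hN : 1 ≤ N) {ρ₁ ρI z : ℝ} (hρ₁ : 0 < ρ₁) (hρI : 0 < ρI)
    (hz : 0 ≤ z) : mmseCdf N M ρ₁ ρI z = 1 - tailFun ρI M N (z / ρ₁) := by
  rw [mmseCdf, sum_hypergeometric_eq N M hρ₁ hρI hz]
  obtain ⟨n, rfl⟩ := Nat.exists_eq_add_of_le' hN
  have hx : 0 ≤ z / ρ₁ := by positivity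
  have h0 : tailFun 0 0 (n + 1) (z / ρ₁) = Real.exp (-(z / ρ₁)) *
      ∑ m ∈ Finset.range (n + 1), (z / ρ₁) ^ m / m.factorial := by
    simp only [tailFun, truncSum, binomExpCoeff, pow_zero, div_one, inv_mul_eq_div]
  rw [upperIncompleteGamma_div_Gamma n hx, h0, tailFun, truncSum_eq_sum_binomPartial,
    Finset.sum_div]
  simp only [mul_sub, Finset.sum_sub_distrib, mul_one, mul_div_assoc]
  ring

end Hypergeometric

/-! ### The interference matrix and the whitened signal power. -/

section InterferenceMatrix

variable {N M : ℕ}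

/-- The matrix `1 + ρ ∑ i, v i (v i)†` of noise and interference with channel vectors `v i`. -/
noncomputable def interferenceMatrix (ρ : ℝ) (v : Fin M → Fin N → ℂ) :
    Matrix (Fin N) (Fin N) ℂ :=
  1 + (ρ : ℂ) • ∑ i, Matrix.vecMulVec (v i) (star (v i))

open scoped ComplexOrder in
lemma posDef_interferenceMatrix {ρ : ℝ} (hρ : 0 ≤ ρ) (v : Fin M → Fin N → ℂ) :
    (interferenceMatrix ρ v).PosDef := by
  refine Matrix.PosDef.one.add_posSemidef (Matrix.PosSemidef.smul
    (Matrix.posSemidef_sum _ fun i _ => Matrix.posSemidef_vecMulVec_self_star _) ?_)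
  exact_mod_cast hρ

lemma dotProduct_vecMulVec_star_mulVec (k u : Fin N → ℂ) :
    star k ⬝ᵥ (Matrix.vecMulVec u (star u) *ᵥ k) = ((‖star k ⬝ᵥ u‖ ^ 2 : ℝ) : ℂ) := by
  have h : star u ⬝ᵥ k = star (star k ⬝ᵥ u) := by
    rw [Matrix.star_dotProduct]
  rw [Matrix.vecMulVec_mulVec, dotProduct_smul, h, op_smul_eq_smul, smul_eq_mul,
    RCLike.star_def, Complex.conj_mul', Complex.ofReal_pow]

lemma re_dotProduct_interferenceMatrix (ρ : ℝ) (v : Fin M → Fin N → ℂ) (k : Fin N → ℂ) :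
    (star k ⬝ᵥ (interferenceMatrix ρ v *ᵥ k)).re =
      frobSq k + ρ * ∑ i, ‖star k ⬝ᵥ v i‖ ^ 2 := by
  have : star k ⬝ᵥ (interferenceMatrix ρ v *ᵥ k) =
      ((frobSq k + ρ * ∑ i, ‖star k ⬝ᵥ v i‖ ^ 2 : ℝ) : ℂ) := by
    rw [interferenceMatrix, Matrix.add_mulVec, Matrix.one_mulVec, dotProduct_add,
      dotProduct_star_self_eq_frobSq, Matrix.smul_mulVec, dotProduct_smul, Matrix.sum_mulVec,
      dotProduct_sum]
    simp only [dotProduct_vecMulVec_star_mulVec]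
    push_cast
    rw [smul_eq_mul]
  rw [this, Complex.ofReal_re]

lemma continuous_interferenceMatrix (ρ : ℝ) :
    Continuous (interferenceMatrix ρ : (Fin M → Fin N → ℂ) → _) := by
  unfold interferenceMatrix
  have h : Continuous fun v : Fin M → Fin N → ℂ => ∑ i, Matrix.vecMulVec (v i) (star (v i)) :=
    continuous_finsetSum _ fun i _ =>
      Continuous.matrix_vecMulVec (continuous_apply i) (continuous_apply i).star
  exact continuous_const.add (h.const_smul (ρ : ℂ))

/-- The signal power `h† (1 + ρ ∑ i, v i (v i)†)⁻¹ h` after whitening. -/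
noncomputable def whitenedPower (ρ : ℝ) (h : Fin N → ℂ) (v : Fin M → Fin N → ℂ) : ℝ :=
  (star h ⬝ᵥ ((interferenceMatrix ρ v)⁻¹ *ᵥ h)).re

open scoped ComplexOrder in
lemma measurable_whitenedPower {ρ : ℝ} (hρ : 0 ≤ ρ) :
    Measurable fun p : (Fin N → ℂ) × (Fin M → Fin N → ℂ) => whitenedPower ρ p.1 p.2 := by
  have e : (fun p : (Fin N → ℂ) × (Fin M → Fin N → ℂ) => whitenedPower ρ p.1 p.2) = fun p =>
      ((interferenceMatrix ρ p.2).det⁻¹ *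
        (star p.1 ⬝ᵥ ((interferenceMatrix ρ p.2).adjugate *ᵥ p.1))).re := by
    ext p
    rw [whitenedPower, Matrix.inv_def, Ring.inverse_eq_inv', Matrix.smul_mulVec, dotProduct_smul,
      smul_eq_mul]
  have hc : Continuous fun p : (Fin N → ℂ) × (Fin M → Fin N → ℂ) => interferenceMatrix ρ p.2 :=
    (continuous_interferenceMatrix ρ).comp continuous_snd
  have hd : ∀ p : (Fin N → ℂ) × (Fin M → Fin N → ℂ), (interferenceMatrix ρ p.2).det ≠ 0 :=
    fun p => (posDef_interferenceMatrix hρ p.2).det_pos.ne'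
  have h1 : Continuous fun p : (Fin N → ℂ) × (Fin M → Fin N → ℂ) =>
      (interferenceMatrix ρ p.2).det⁻¹ := hc.matrix_det.inv₀ hd
  have h2 : Continuous fun p : (Fin N → ℂ) × (Fin M → Fin N → ℂ) =>
      (interferenceMatrix ρ p.2).adjugate *ᵥ p.1 :=
    hc.matrix_adjugate.matrix_mulVec continuous_fst
  have h3 : Continuous fun p : (Fin N → ℂ) × (Fin M → Fin N → ℂ) =>
      star p.1 ⬝ᵥ ((interferenceMatrix ρ p.2).adjugate *ᵥ p.1) :=
    Continuous.dotProduct continuous_fst.star h2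
  rw [e]
  exact (Complex.continuous_re.comp (h1.mul h3)).measurable

open Polynomial in
-- With R = 1 + ρ k k†, det R · det(1 + X R⁻¹) = det((1+X) + ρ k k†), again a rank-one update. The
-- factor det R stays on the left to avoid dividing.
lemma pencilDet_inv_rankOne (n : ℕ) {ρ : ℝ} (hρ : 0 ≤ ρ) (k : Fin (n + 1) → ℂ) :
    C ((1 + ρ * frobSq k : ℝ) : ℂ) *
        pencilDet (interferenceMatrix ρ fun _ : Fin 1 => k)⁻¹ 1 =
      C 1 * (1 + X) ^ (n + 1) + C ((ρ * frobSq k : ℝ) : ℂ) * (1 + X) ^ n := by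
  set R := interferenceMatrix ρ fun _ : Fin 1 => k with hR
  have hdR : R.det ≠ 0 := by
    open scoped ComplexOrder in exact (posDef_interferenceMatrix hρ _).det_pos.ne'
  have hRi : R * R⁻¹ = 1 := Matrix.mul_nonsing_inv R (isUnit_iff_ne_zero.mpr hdR)
  have hsum : ∑ a, (C (ρ : ℂ) * C (k a)) * C (star (k a)) = C ((ρ * frobSq k : ℝ) : ℂ) := by
    have := dotProduct_star_self_eq_frobSq k
    simp only [dotProduct, Pi.star_apply] at this
    push_cast
    rw [← this, C_mul, map_sum, Finset.mul_sum]
    refine Finset.sum_congr rfl fun a _ => ?_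
    rw [C_mul]; ring
  have hdet : ∀ c : ℂ[X], (c • (1 : Matrix (Fin (n + 1)) (Fin (n + 1)) ℂ[X]) +
      Matrix.vecMulVec (fun a => C (ρ : ℂ) * C (k a)) (fun a => C (star (k a)))).det =
        c ^ (n + 1) + C ((ρ * frobSq k : ℝ) : ℂ) * c ^ n := by
    intro c
    rw [Matrix.det_add_vecMulVec_eq, Matrix.det_smul, Matrix.det_one, Matrix.adjugate_smul,
      Matrix.adjugate_one, Fintype.card_fin, mul_one, Nat.add_sub_cancel, ← hsum, Finset.sum_mul]
    congr 1
    refine Finset.sum_congr rfl fun a _ => ?_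
    rw [Finset.sum_eq_single a]
    · simp
    · intro b _ hb; simp [hb]
    · simp
  have hRC : R.map C = (1 : ℂ[X]) • (1 : Matrix (Fin (n + 1)) (Fin (n + 1)) ℂ[X]) +
      Matrix.vecMulVec (fun a => C (ρ : ℂ) * C (k a)) (fun a => C (star (k a))) := by
    ext1 a b
    simp only [hR, interferenceMatrix, Finset.univ_unique, Finset.sum_const, Finset.card_singleton,
      one_smul, Matrix.map_apply, Matrix.add_apply, Matrix.smul_apply, Matrix.vecMulVec_apply,
      Pi.star_apply, smul_eq_mul, C_add, C_mul, Matrix.one_apply, mul_assoc]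
    split_ifs <;> simp
  have hdetR : (R.map C).det = C ((1 + ρ * frobSq k : ℝ) : ℂ) := by
    rw [hRC, hdet, one_pow, one_pow, mul_one, Complex.ofReal_add, C_add]; simp
  have hmul : R.map C * R⁻¹.map C = (1 : Matrix (Fin (n + 1)) (Fin (n + 1)) ℂ[X]) := by
    rw [← Matrix.map_mul, hRi, Matrix.map_one _ C_0 C_1]
  rw [← hdetR, pencilDet, ← Matrix.det_mul, Matrix.mul_add, Matrix.mul_smul, hmul,
    Matrix.map_one _ C_0 C_1, mul_one, hRC, C_1, one_mul, ← hdet]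
  congr 1
  rw [add_smul]; abel

lemma det_rankOne (n : ℕ) {ρ : ℝ} (k : Fin (n + 1) → ℂ) :
    (interferenceMatrix ρ fun _ : Fin 1 => k).det = ((1 + ρ * frobSq k : ℝ) : ℂ) := by
  rw [interferenceMatrix]
  have : (ρ : ℂ) • ∑ _i : Fin 1, Matrix.vecMulVec k (star k) =
      Matrix.vecMulVec ((ρ : ℂ) • k) (star k) := by
    ext a b; simp [Matrix.vecMulVec_apply, mul_assoc]
  rw [this, Matrix.det_add_vecMulVec_eq, Matrix.det_one, Matrix.adjugate_one]
  have := dotProduct_star_self_eq_frobSq k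
  simp only [dotProduct, Pi.star_apply] at this
  push_cast
  rw [← this, Finset.mul_sum]
  congr 1
  refine Finset.sum_congr rfl fun a _ => ?_
  rw [Finset.sum_eq_single a]
  · simp; ring
  · intro b _ hb; simp [hb]
  · simp

end InterferenceMatrix

/-! ### Tail of the whitened power, averaged over the interferers. -/

section TailFormula

variable {N M : ℕ}

/-- The law of the interferer channel vectors: `M` independent Gaussian vectors. -/
noncomputable abbrev gaussianCols (N M : ℕ) : Measure (Fin M → Fin N → ℂ) :=
  Measure.pi fun _ => gaussianVec N

/-- With k = R^{-1/2} h the event becomes |k|² > x, and `k` has relative density det R · exp(|k|² -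
k† R k), whose exponent is the interference term. -/
lemma gaussianVec_whitenedPower_gt {ρ : ℝ} (hρ : 0 ≤ ρ) (v : Fin M → Fin N → ℂ) (x : ℝ) :
    gaussianVec N {h | x < whitenedPower ρ h v} =
      ∫⁻ k in {k : Fin N → ℂ | x < frobSq k}, ENNReal.ofReal ((interferenceMatrix ρ v).det.re *
        Real.exp (-(ρ * ∑ i, ‖star k ⬝ᵥ v i‖ ^ 2))) ∂(gaussianVec N) := by
  obtain ⟨T, hTh, hTT, hmap⟩ :=
    exists_map_gaussianVec_eq_withDensity _ (posDef_interferenceMatrix hρ v)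
  have hset : MeasurableSet {k : Fin N → ℂ | x < frobSq k} :=
    measurableSet_lt measurable_const measurable_frobSq
  have hpre : {h | x < whitenedPower ρ h v} = (fun k => T *ᵥ k) ⁻¹' {k | x < frobSq k} := by
    ext h
    have : whitenedPower ρ h v = frobSq (T *ᵥ h) := by
      have h1 := dotProduct_star_self_eq_frobSq (T *ᵥ h)
      rw [Matrix.star_mulVec, hTh, ← Matrix.dotProduct_mulVec, Matrix.mulVec_mulVec, hTT] at h1
      rw [whitenedPower, h1, Complex.ofReal_re]
    simp [this]
  rw [hpre, ← Measure.map_apply (measurable_mulVec T) hset, hmap, withDensity_apply _ hset]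
  refine lintegral_congr fun k => ?_
  rw [re_dotProduct_interferenceMatrix]
  congr 4
  ring

lemma lintegral_ofReal_re {Ω : Type*} [MeasurableSpace Ω] {μ : Measure Ω} {f : Ω → ℂ}
    (hf : Integrable f μ) (h0 : ∀ x, 0 ≤ (f x).re) :
    ∫⁻ x, ENNReal.ofReal (f x).re ∂μ = ENNReal.ofReal (∫ x, f x ∂μ).re := by
  have h1 : ∫ x, (f x).re ∂μ = (∫ x, f x ∂μ).re := integral_re hf
  rw [← h1]
  exact (ofReal_integral_eq_lintegral_ofReal hf.re (ae_of_all _ h0)).symm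

/-- The weighted expected determinant of the interference matrix. -/
lemma lintegral_det_interferenceMatrix (n M : ℕ) {ρ : ℝ} (hρ : 0 ≤ ρ) (k : Fin (n + 1) → ℂ) :
    ∫⁻ v, ENNReal.ofReal ((interferenceMatrix ρ v).det.re *
        Real.exp (-(ρ * ∑ i, ‖star k ⬝ᵥ v i‖ ^ 2))) ∂(gaussianCols (n + 1) M) =
      ENNReal.ofReal (((n + 1).factorial * binomExpCoeff ρ M (n + 1) +
        ρ * frobSq k * (n.factorial * binomExpCoeff ρ M n)) / (1 + ρ * frobSq k) ^ (M + 1)) := by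
  set R := interferenceMatrix ρ fun _ : Fin 1 => k with hR
  set p : ℝ := 1 + ρ * frobSq k with hp
  have hp0 : 0 < p := by have := frobSq_nonneg k; positivity
  obtain ⟨T, hTh, hTT, hmap⟩ :=
    exists_map_gaussianVec_eq_withDensity R (posDef_interferenceMatrix hρ _)
  have hdR : R.det.re = p := by rw [hR, det_rankOne, Complex.ofReal_re]
  -- `f` is the density of the Gaussian law of covariance R⁻¹ relative to the standard one; its
  -- constant `p` is det R.
  set f : (Fin (n + 1) → ℂ) → ENNReal := fun h =>
    ENNReal.ofReal (p * Real.exp (-(ρ * ‖star k ⬝ᵥ h‖ ^ 2))) with hf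
  have hfm : Measurable f := by
    have : Continuous fun h : Fin (n + 1) → ℂ => star k ⬝ᵥ h :=
      Continuous.dotProduct continuous_const continuous_id
    exact (ENNReal.continuous_ofReal.comp (by fun_prop)).measurable
  have hmap' : (gaussianVec (n + 1)).map (fun h => T *ᵥ h) = (gaussianVec (n + 1)).withDensity f := by
    rw [hmap]
    congr 1
    ext h
    rw [hdR, hR, re_dotProduct_interferenceMatrix, hf]
    have : ‖star h ⬝ᵥ k‖ = ‖star k ⬝ᵥ h‖ := by
      rw [← norm_star (star h ⬝ᵥ k), ← Matrix.star_dotProduct]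
    simp only [Finset.univ_unique, Finset.sum_const, Finset.card_singleton, one_smul, this]
    congr 3; ring
  have hTm := measurable_mulVec T
  have hprob : IsProbabilityMeasure ((gaussianVec (n + 1)).map (fun h => T *ᵥ h)) :=
    Measure.isProbabilityMeasure_map hTm.aemeasurable
  have hprob' : IsProbabilityMeasure ((gaussianVec (n + 1)).withDensity f) := hmap' ▸ hprob
  have hdm : Measurable fun v : Fin M → Fin (n + 1) → ℂ =>
      ENNReal.ofReal (interferenceMatrix ρ v).det.re :=
    (ENNReal.continuous_ofReal.comp (Complex.continuous_re.comp
      (continuous_interferenceMatrix ρ).matrix_det)).measurable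
  have hpd : ∀ v : Fin M → Fin (n + 1) → ℂ, 0 ≤ (interferenceMatrix ρ v).det.re := fun v => by
    open scoped ComplexOrder in
      exact (Complex.le_def.mp (posDef_interferenceMatrix hρ v).det_pos.le).1
  -- the weights turn the law of the columns into a Gaussian law with covariance `R⁻¹`
  have hweight : ENNReal.ofReal (p ^ M) *
      ∫⁻ v, ENNReal.ofReal ((interferenceMatrix ρ v).det.re *
        Real.exp (-(ρ * ∑ i, ‖star k ⬝ᵥ v i‖ ^ 2))) ∂(gaussianCols (n + 1) M) =
      ∫⁻ v, ENNReal.ofReal (interferenceMatrix ρ fun i => T *ᵥ v i).det.re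
        ∂(gaussianCols (n + 1) M) := by
    have h1 : (gaussianCols (n + 1) M).map (fun v i => T *ᵥ v i) =
        (gaussianCols (n + 1) M).withDensity fun v => ∏ i, f (v i) := by
      rw [← pi_withDensity _ _ hfm, ← hmap']
      exact Measure.pi_map_pi fun _ => hTm.aemeasurable
    have hTm' : Measurable fun (v : Fin M → Fin (n + 1) → ℂ) i => T *ᵥ v i :=
      measurable_pi_lambda _ fun i => hTm.comp (measurable_pi_apply i)
    have hprodm : Measurable fun v : Fin M → Fin (n + 1) → ℂ => ∏ i, f (v i) :=
      Finset.measurable_prod _ fun i _ => hfm.comp (measurable_pi_apply i)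
    rw [← lintegral_map hdm hTm', h1, lintegral_withDensity_eq_lintegral_mul _ hprodm hdm,
      ← lintegral_const_mul' _ _ ENNReal.ofReal_ne_top]
    refine lintegral_congr fun v => ?_
    rw [Pi.mul_apply, ← ENNReal.ofReal_prod_of_nonneg fun i _ => by positivity,
      Finset.prod_mul_distrib, Finset.prod_const, Finset.card_univ, Fintype.card_fin,
      ← Real.exp_sum, ← ENNReal.ofReal_mul (by positivity), ← ENNReal.ofReal_mul (by positivity),
      Finset.sum_neg_distrib, Finset.mul_sum]
    congr 1; ring
  have hcoord := coord_mem_momentSubring_map T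
  have hS : ∀ a b, ∫ h, (T *ᵥ h) a * star ((T *ᵥ h) b) ∂(gaussianVec (n + 1)) = R⁻¹ a b :=
    fun a b => by rw [integral_mul_star_map, hTh, hTT]
  have hcoeff : ∀ v : Fin M → Fin (n + 1) → ℂ, (pencilDet R⁻¹ (1 + (ρ : ℂ) •
      ∑ i, Matrix.vecMulVec (T *ᵥ v i) (star (T *ᵥ v i)))).coeff 0 =
        (interferenceMatrix ρ fun i => T *ᵥ v i).det := by
    intro v
    rw [pencilDet, Polynomial.coeff_zero_eq_eval_zero, eval_det_add_X_smul,
      ← RingHom.mapMatrix_apply, ← RingHom.map_det, Polynomial.eval_C]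
    rfl
  have hint : Integrable (fun v : Fin M → Fin (n + 1) → ℂ =>
      (interferenceMatrix ρ fun i => T *ᵥ v i).det) (gaussianCols (n + 1) M) := by
    simp only [← hcoeff]
    exact integrable_of_mem_momentSubring
      (pencilDet_mem_polyMomentSubring (gram_mem_momentSubring hcoord M 1 (ρ : ℂ)) 0)
  set c : ℝ := (n + 1).factorial * binomExpCoeff ρ M (n + 1) +
    ρ * frobSq k * (n.factorial * binomExpCoeff ρ M n) with hc
  have hE : ∫ v, (interferenceMatrix ρ fun i => T *ᵥ v i).det ∂(gaussianCols (n + 1) M) =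
      ((c / p : ℝ) : ℂ) := by
    have h1 := integral_coeff_pencilDet_gram hcoord hS 1 (ρ : ℂ) M 0
    simp only [hcoeff] at h1
    have h2 := congrArg (fun q => ((addDeriv (ρ : ℂ))^[M] q).coeff 0) (pencilDet_inv_rankOne n hρ k)
    have h3 := addDeriv_iterate_linear (ρ : ℂ) M ((p : ℝ) : ℂ) 0 (pencilDet R⁻¹ 1) 0
    simp only [Polynomial.C_0, zero_mul, add_zero] at h3
    simp only [addDeriv_iterate_linear, Polynomial.coeff_add, Polynomial.coeff_C_mul,
      coeff_zero_addDeriv_iterate] at h2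
    rw [h3, Polynomial.coeff_C_mul] at h2
    rw [h1, Complex.ofReal_div, eq_div_iff (by exact_mod_cast hp0.ne'), mul_comm, h2, hc]
    push_cast
    ring
  -- The mean determinant carries 1/p and the M tilted columns carry p^(-M); together they give the
  -- exponent M + 1.
  rw [lintegral_ofReal_re hint fun v => hpd _, hE, Complex.ofReal_re] at hweight
  have hpM : ENNReal.ofReal (p ^ M) ≠ 0 := (ENNReal.ofReal_pos.mpr (by positivity)).ne'
  refine (ENNReal.mul_right_inj hpM ENNReal.ofReal_ne_top).mp (hweight.trans ?_)
  rw [← ENNReal.ofReal_mul (by positivity), pow_succ]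
  congr 1
  field_simp

/-- The tail of the whitened signal power for Gaussian channels. -/
theorem lintegral_gaussianVec_whitenedPower_gt (n M : ℕ) {ρ x : ℝ} (hρ : 0 ≤ ρ) (hx : 0 ≤ x) :
    ∫⁻ v, gaussianVec (n + 1) {h | x < whitenedPower ρ h v} ∂(gaussianCols (n + 1) M) =
      ENNReal.ofReal (tailFun ρ M (n + 1) x) := by
  have hset : MeasurableSet {k : Fin (n + 1) → ℂ | x < frobSq k} :=
    measurableSet_lt measurable_const measurable_frobSq
  simp only [gaussianVec_whitenedPower_gt hρ]
  -- The columns are integrated first: their average depends on `k` only through `frobSq k`, leaving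
  -- a one-dimensional radial integral.
  rw [lintegral_lintegral_swap]
  · simp only [lintegral_det_interferenceMatrix n M hρ]
    set J : ℝ → ENNReal := fun r => ENNReal.ofReal (((n + 1).factorial *
      binomExpCoeff ρ M (n + 1) + ρ * r * (n.factorial * binomExpCoeff ρ M n)) /
        (1 + ρ * r) ^ (M + 1)) with hJ
    have h1 : ∫⁻ k in {k : Fin (n + 1) → ℂ | x < frobSq k}, J (frobSq k) ∂(gaussianVec (n + 1)) =
        ∫⁻ k, (Set.Ioi x).indicator J (frobSq k) ∂(gaussianVec (n + 1)) := by
      rw [← lintegral_indicator hset]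
      rfl
    have hJm : Measurable J := by fun_prop
    rw [h1, lintegral_frobSq_gaussianVec n _ (hJm.indicator measurableSet_Ioi),
      ← lintegral_tailDensity hρ M n hx, ← lintegral_indicator measurableSet_Ioi,
      ← lintegral_indicator measurableSet_Ioi]
    refine lintegral_congr fun r => ?_
    by_cases hr : x < r
    · have hr0 : 0 < r := hx.trans_lt hr
      rw [Set.indicator_of_mem (show r ∈ Set.Ioi (0 : ℝ) from hr0),
        Set.indicator_of_mem (show r ∈ Set.Ioi x from hr),
        Set.indicator_of_mem (show r ∈ Set.Ioi x from hr), hJ, mul_comm,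
        ← ENNReal.ofReal_mul (by positivity), tailDensity, Nat.factorial_succ]
      have hp : (1 + ρ * r) ^ (M + 1) ≠ 0 := by positivity
      congr 1
      push_cast
      field_simp
    · rw [Set.indicator_of_notMem (show r ∉ Set.Ioi x from hr)]
      by_cases hr0 : r ∈ Set.Ioi (0 : ℝ)
      · rw [Set.indicator_of_mem hr0, Set.indicator_of_notMem (show r ∉ Set.Ioi x from hr), zero_mul]
      · rw [Set.indicator_of_notMem hr0]
  · have hc : Continuous fun p : (Fin M → Fin (n + 1) → ℂ) × (Fin (n + 1) → ℂ) =>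
        (interferenceMatrix ρ p.1).det.re * Real.exp (-(ρ * ∑ i, ‖star p.2 ⬝ᵥ p.1 i‖ ^ 2)) := by
      have h1 : Continuous fun p : (Fin M → Fin (n + 1) → ℂ) × (Fin (n + 1) → ℂ) =>
          (interferenceMatrix ρ p.1).det.re := Complex.continuous_re.comp
        (((continuous_interferenceMatrix ρ).comp continuous_fst).matrix_det)
      have h2 : ∀ i, Continuous fun p : (Fin M → Fin (n + 1) → ℂ) × (Fin (n + 1) → ℂ) =>
          star p.2 ⬝ᵥ p.1 i := fun i =>
        Continuous.dotProduct continuous_snd.star ((continuous_apply i).comp continuous_fst)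
      fun_prop
    exact (ENNReal.continuous_ofReal.comp hc).measurable.aemeasurable

/-- The tail of the squared norm of a Gaussian vector. -/
lemma gaussianVec_frobSq_gt (n : ℕ) {x : ℝ} (hx : 0 ≤ x) :
    gaussianVec (n + 1) {k | x < frobSq k} = ENNReal.ofReal (tailFun 0 0 (n + 1) x) := by
  have hset : MeasurableSet {k : Fin (n + 1) → ℂ | x < frobSq k} :=
    measurableSet_lt measurable_const measurable_frobSq
  have h1 : gaussianVec (n + 1) {k | x < frobSq k} =
      ∫⁻ k, (Set.Ioi x).indicator 1 (frobSq k) ∂(gaussianVec (n + 1)) := by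
    rw [← lintegral_indicator_one hset]
    rfl
  rw [h1, lintegral_frobSq_gaussianVec n _ (measurable_one.indicator measurableSet_Ioi),
    ← lintegral_tailDensity le_rfl 0 n hx, ← lintegral_indicator measurableSet_Ioi,
    ← lintegral_indicator measurableSet_Ioi]
  refine lintegral_congr fun r => ?_
  by_cases hr : x < r
  · rw [Set.indicator_of_mem (show r ∈ Set.Ioi (0 : ℝ) from hx.trans_lt hr),
      Set.indicator_of_mem (show r ∈ Set.Ioi x from hr),
      Set.indicator_of_mem (show r ∈ Set.Ioi x from hr), tailDensity_zero_zero]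
    simp
  · rw [Set.indicator_of_notMem (show r ∉ Set.Ioi x from hr)]
    by_cases hr0 : r ∈ Set.Ioi (0 : ℝ)
    · rw [Set.indicator_of_mem hr0, Set.indicator_of_notMem (show r ∉ Set.Ioi x from hr), zero_mul]
    · rw [Set.indicator_of_notMem hr0]

end TailFormula

/-! ### Signal ratios for one channel realization. -/

section Realization

variable {N M : ℕ}

lemma mul_conjTranspose_eq_sum_vecMulVec (H : Matrix (Fin N) (Fin M) ℂ) :
    H * Hᴴ = ∑ i, Matrix.vecMulVec (H.col i) (star (H.col i)) := by
  ext a b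
  simp [Matrix.mul_apply, Matrix.sum_apply, Matrix.vecMulVec_apply]

lemma frobSq_smul (c : ℂ) (v : Fin N → ℂ) : frobSq (c • v) = ‖c‖ ^ 2 * frobSq v := by
  simp only [frobSq, Pi.smul_apply, smul_eq_mul, norm_mul, mul_pow, Finset.mul_sum]

lemma frobSq_star (v : Fin N → ℂ) : frobSq (star v) = frobSq v := by
  simp [frobSq]

lemma combinedInterference_smul (ρI : ℝ) (H : Matrix (Fin N) (Fin M) ℂ) (c : ℂ)
    (w : Fin N → ℂ) :
    combinedInterference ρI H (c • w) = ‖c‖ ^ 2 * combinedInterference ρI H w := by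
  simp only [combinedInterference, frobSq_smul, smul_dotProduct, smul_eq_mul, norm_mul, mul_pow,
    mul_add, Finset.mul_sum, mul_assoc]

open scoped ComplexOrder in
/-- The MMSE combiner is a positive multiple of the whitened matched filter. -/
lemma exists_mmseCombiner_eq_smul {ρI : ℝ} (hρI : 0 < ρI) (h₁ : Fin N → ℂ)
    (H : Matrix (Fin N) (Fin M) ℂ) :
    0 ≤ whitenedPower ρI h₁ H.col ∧ ∃ c : ℝ, 0 < c ∧
      ‖mmseCombiner ρI h₁ H ⬝ᵥ h₁‖ ^ 2 = c ^ 2 * whitenedPower ρI h₁ H.col ^ 2 ∧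
      combinedInterference ρI H (mmseCombiner ρI h₁ H) = c ^ 2 * whitenedPower ρI h₁ H.col := by
  set R := interferenceMatrix ρI H.col with hR
  have hRpd : R.PosDef := posDef_interferenceMatrix hρI.le _
  have hRu : IsUnit R.det := isUnit_iff_ne_zero.mpr hRpd.det_pos.ne'
  have hRh : R⁻¹ᴴ = R⁻¹ := by rw [Matrix.conjTranspose_nonsing_inv, hRpd.1]
  set y := whitenedPower ρI h₁ H.col with hy
  have hnn : 0 ≤ star h₁ ⬝ᵥ (R⁻¹ *ᵥ h₁) := hRpd.inv.posSemidef.dotProduct_mulVec_nonneg h₁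
  have hy0 : 0 ≤ y := (Complex.le_def.mp hnn).1
  have hyc : star h₁ ⬝ᵥ (R⁻¹ *ᵥ h₁) = (y : ℂ) :=
    Complex.ext rfl (by simpa using (Complex.le_def.mp hnn).2.symm)
  set G : Fin N → ℂ := star h₁ ᵥ* R⁻¹ with hG
  have hGh : G ⬝ᵥ h₁ = (y : ℂ) := by rw [hG, ← Matrix.dotProduct_mulVec, hyc]
  have hstarG : star G = R⁻¹ *ᵥ h₁ := by
    rw [hG, Matrix.star_vecMul, star_star, hRh]
  have hCI : combinedInterference ρI H G = y := by
    have h1 := re_dotProduct_interferenceMatrix ρI H.col (star G)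
    rw [star_star, ← hR, hstarG, Matrix.mulVec_mulVec, Matrix.mul_nonsing_inv R hRu,
      Matrix.one_mulVec, hGh, Complex.ofReal_re, ← hstarG, frobSq_star] at h1
    rw [combinedInterference, h1, ← Finset.sum_mul]
    ring
  set A := Matrix.vecMulVec h₁ (star h₁) + H * Hᴴ + ((1 / ρI : ℝ) : ℂ) • 1 with hA
  have hρ : (ρI : ℂ) ≠ 0 := by exact_mod_cast hρI.ne'
  have hAR : A = Matrix.vecMulVec h₁ (star h₁) + ((1 / ρI : ℝ) : ℂ) • R := by
    rw [hA, hR, interferenceMatrix, mul_conjTranspose_eq_sum_vecMulVec, smul_add, smul_smul]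
    push_cast
    rw [one_div_mul_cancel hρ, one_smul, add_assoc, add_comm (Finset.sum _ _)]
  have hApd : A.PosDef := by
    rw [hAR, add_comm]
    refine (hRpd.smul ?_).add_posSemidef (Matrix.posSemidef_vecMulVec_self_star _)
    exact_mod_cast one_div_pos.mpr hρI
  have hAu : IsUnit A.det := isUnit_iff_ne_zero.mpr hApd.det_pos.ne'
  have hden : 0 < y + 1 / ρI := by positivity
  -- A = h₁ h₁† + R/ρI, so G A = (G h₁) h₁† + h₁†/ρI. Applying A⁻¹ shows that the combiner is G
  -- divided by y + 1/ρI.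
  have hGA : G ᵥ* A = ((y + 1 / ρI : ℝ) : ℂ) • star h₁ := by
    rw [hAR, Matrix.vecMul_add, Matrix.vecMul_vecMulVec, hGh, Matrix.vecMul_smul, hG,
      Matrix.vecMul_vecMul, Matrix.nonsing_inv_mul R hRu, Matrix.vecMul_one, ← add_smul]
    push_cast; rfl
  have hw : mmseCombiner ρI h₁ H = (((y + 1 / ρI)⁻¹ : ℝ) : ℂ) • G := by
    have h1 : star h₁ = (((y + 1 / ρI)⁻¹ : ℝ) : ℂ) • (G ᵥ* A) := by
      rw [hGA, smul_smul, ← Complex.ofReal_mul, inv_mul_cancel₀ hden.ne', Complex.ofReal_one,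
        one_smul]
    rw [mmseCombiner, ← hA, h1, Matrix.smul_vecMul, Matrix.vecMul_vecMul,
      Matrix.mul_nonsing_inv A hAu, Matrix.vecMul_one]
  refine ⟨hy0, (y + 1 / ρI)⁻¹, inv_pos.mpr hden, ?_, ?_⟩
  · rw [hw, smul_dotProduct, hGh, smul_eq_mul, norm_mul, mul_pow, Complex.norm_real,
      Complex.norm_real, Real.norm_eq_abs, Real.norm_eq_abs, sq_abs, sq_abs]
  · rw [hw, combinedInterference_smul, hCI, Complex.norm_real, Real.norm_eq_abs, sq_abs]

lemma mmseZ_eq {ρI : ℝ} (ρ₁ : ℝ) (hρI : 0 < ρI) (h₁ : Fin N → ℂ)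
    (H : Matrix (Fin N) (Fin M) ℂ) :
    mmseZ ρ₁ ρI h₁ H = ρ₁ * whitenedPower ρI h₁ H.col := by
  obtain ⟨hy, c, hc, h1, h2⟩ := exists_mmseCombiner_eq_smul hρI h₁ H
  rw [mmseZ, h1, h2]
  rcases hy.eq_or_lt with h0 | h0
  · simp [← h0]
  · field_simp

/-- The end-to-end ratio of the MMSE/MRT scheme in terms of the ratios of the two hops. -/
lemma mmseMrtSINR_eq {Ps Pr PI N₀ : ℝ} (hPs : 0 < Ps) (hPr : 0 < Pr) (hPI : 0 < PI) (hN₀ : 0 < N₀)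
    (h₁ : Fin N → ℂ) (H : Matrix (Fin N) (Fin M) ℂ) (h₂ : Fin N → ℂ) :
    mmseMrtSINR Ps Pr PI N₀ h₁ H h₂ =
      (Ps / N₀ * whitenedPower (PI / N₀) h₁ H.col) * (Pr / N₀ * frobSq h₂) /
        (Ps / N₀ * whitenedPower (PI / N₀) h₁ H.col + Pr / N₀ * frobSq h₂ + 1) := by
  have hρI : 0 < PI / N₀ := by positivity
  obtain ⟨hy, c, hc, h1, h2⟩ := exists_mmseCombiner_eq_smul hρI h₁ H
  have hf0 := frobSq_nonneg h₂
  set w := mmseCombiner (PI / N₀) h₁ H with hw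
  set y := whitenedPower (PI / N₀) h₁ H.col with hydef
  set f := frobSq h₂ with hf
  set om := mmsePowerFactor (Ps / N₀) (Pr / N₀) (PI / N₀) h₁ H with hom
  have hom2 : om ^ 2 = Pr / N₀ / (c ^ 2 * y ^ 2 * (Ps / N₀) + c ^ 2 * y) := by
    rw [hom, mmsePowerFactor, ← hw, h1, h2, Real.sq_sqrt (by positivity)]
  set κ : ℝ := om / √f with hκ
  -- When h₂ = 0 both sides vanish, so the convention for division by zero does no harm.
  have hκf : (κ * f) ^ 2 = om ^ 2 * f := by
    rcases hf0.eq_or_lt with h0 | h0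
    · simp [← h0]
    · rw [hκ, mul_pow, div_pow, Real.sq_sqrt hf0]; field_simp
  have hself : h₂ ⬝ᵥ star h₂ = (f : ℂ) := by
    rw [dotProduct_comm, dotProduct_star_self_eq_frobSq]
  have hW : ∀ x : Fin N → ℂ,
      ‖h₂ ⬝ᵥ (mmseMrtPrecoder (Ps / N₀) (Pr / N₀) (PI / N₀) h₁ H h₂ *ᵥ x)‖ ^ 2 =
        om ^ 2 * f * ‖w ⬝ᵥ x‖ ^ 2 := by
    intro x
    rw [mmseMrtPrecoder, Matrix.smul_mulVec, Matrix.vecMulVec_mulVec, dotProduct_smul,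
      dotProduct_smul, hself, op_smul_eq_smul, smul_eq_mul, smul_eq_mul, norm_mul, norm_mul,
      Complex.norm_real, Complex.norm_real, ← hκf, Real.norm_eq_abs, Real.norm_eq_abs, mul_pow,
      mul_pow, sq_abs, sq_abs]
    ring
  have hWrow : frobSq (h₂ ᵥ* mmseMrtPrecoder (Ps / N₀) (Pr / N₀) (PI / N₀) h₁ H h₂) =
      om ^ 2 * f * frobSq w := by
    rw [mmseMrtPrecoder, Matrix.vecMul_smul, Matrix.vecMul_vecMulVec, hself, smul_smul,
      ← Complex.ofReal_mul, frobSq_smul, Complex.norm_real, Real.norm_eq_abs, sq_abs, ← hκf]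
  have hCI : ∑ i, om ^ 2 * f * ‖w ⬝ᵥ H.col i‖ ^ 2 * PI + om ^ 2 * f * frobSq w * N₀ =
      om ^ 2 * f * (c ^ 2 * y) * N₀ := by
    rw [← h2, combinedInterference, ← Finset.sum_mul, ← Finset.sum_mul, ← Finset.mul_sum]
    field_simp
  rw [mmseMrtSINR, endToEndSINR]
  simp only [hW, hWrow]
  rw [hCI, h1, hom2]
  -- If y = 0, the denominator of ω² is zero, so ω² = 0 by convention and both sides are 0.
  rcases hy.eq_or_lt with h0 | h0
  · simp [← h0]
  · have : c ^ 2 * y ^ 2 * (Ps / N₀) + c ^ 2 * y = c ^ 2 * y * (y * (Ps / N₀) + 1) := by ring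
    rw [this]
    field_simp
    ring

/-- If a ≤ γ, then ab ≤ γb < γ(a + b + 1), and symmetrically in b; the +1 makes the inequality
strict. -/
lemma mmseMrtSINR_lt {Ps Pr PI N₀ γ : ℝ} (hPs : 0 < Ps) (hPr : 0 < Pr) (hPI : 0 < PI)
    (hN₀ : 0 < N₀) (hγ : 0 < γ) (h₁ : Fin N → ℂ) (H : Matrix (Fin N) (Fin M) ℂ) (h₂ : Fin N → ℂ)
    (h : Ps / N₀ * whitenedPower (PI / N₀) h₁ H.col ≤ γ ∨ Pr / N₀ * frobSq h₂ ≤ γ) :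
    mmseMrtSINR Ps Pr PI N₀ h₁ H h₂ < γ := by
  rw [mmseMrtSINR_eq hPs hPr hPI hN₀]
  have ha : 0 ≤ Ps / N₀ * whitenedPower (PI / N₀) h₁ H.col :=
    mul_nonneg (by positivity) (exists_mmseCombiner_eq_smul (by positivity) h₁ H).1
  have hb : 0 ≤ Pr / N₀ * frobSq h₂ := mul_nonneg (by positivity) (frobSq_nonneg h₂)
  generalize Ps / N₀ * whitenedPower (PI / N₀) h₁ H.col = a at ha h ⊢
  generalize Pr / N₀ * frobSq h₂ = b at hb h ⊢
  rw [div_lt_iff₀ (by positivity)]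
  rcases h with h | h
  · nlinarith [mul_le_mul_of_nonneg_right h hb, mul_nonneg hγ.le ha]
  · nlinarith [mul_le_mul_of_nonneg_left h ha, mul_nonneg hγ.le hb]

end Realization

/-! ### From i.i.d. entries to the joint law of the channels. -/

section ChannelLaw

/-- Entries are indexed by (row, column), but the determinant average needs independent columns. The
inverse reindexing is checked on boxes. -/
lemma map_curry_swap_pi {E : Type*} [MeasurableSpace E] (P : Measure E) [IsProbabilityMeasure P]
    (N M : ℕ) :
    MeasurePreserving (fun (f : Fin N × Fin M → E) (i : Fin M) (j : Fin N) => f (j, i))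
      (Measure.pi fun _ => P) (Measure.pi fun _ => Measure.pi fun _ => P) := by
  have hm : Measurable fun (f : Fin N × Fin M → E) (i : Fin M) (j : Fin N) => f (j, i) := by
    fun_prop
  have hm' : Measurable fun (v : Fin M → Fin N → E) (p : Fin N × Fin M) => v p.2 p.1 := by
    fun_prop
  refine ⟨hm, ?_⟩
  have h : (Measure.pi fun _ : Fin N × Fin M => P) =
      (Measure.pi fun _ : Fin M => Measure.pi fun _ : Fin N => P).map
        fun v p => v p.2 p.1 := by
    refine Measure.pi_eq fun s hs => ?_
    have hpre : (fun (v : Fin M → Fin N → E) (p : Fin N × Fin M) => v p.2 p.1) ⁻¹'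
        Set.univ.pi s = Set.univ.pi fun i => Set.univ.pi fun j => s (j, i) := by
      ext v
      simp only [Set.mem_preimage, Set.mem_pi, Set.mem_univ, true_imp_iff, Prod.forall]
      exact forall_comm
    rw [Measure.map_apply hm' (MeasurableSet.univ_pi hs), hpre, Measure.pi_pi]
    simp only [Measure.pi_pi]
    rw [Fintype.prod_prod_type, Finset.prod_comm]
  rw [h, Measure.map_map hm hm']
  exact Measure.map_id

variable {Ω : Type*} [MeasurableSpace Ω] {μ : Measure Ω} {N M : ℕ}
  {h₁ : Ω → Fin N → ℂ} {H : Ω → Matrix (Fin N) (Fin M) ℂ} {h₂ : Ω → Fin N → ℂ}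

/-- The joint law of the three channels under Rayleigh fading. -/
lemma IsRayleighFading.hasLaw_channels (hf : IsRayleighFading μ h₁ H h₂) :
    HasLaw (fun ω => ((h₁ ω, (H ω).col), h₂ ω))
      (((gaussianVec N).prod (gaussianCols N M)).prod (gaussianVec N)) μ := by
  have hall := hf.indep.hasLaw_pi hf.hasLaw
  have hmp1 := measurePreserving_sumPiEquivProdPi
    (fun _ : Fin N ⊕ (Fin N × Fin M) ⊕ Fin N => stdComplexGaussian)
  have hmp2 := measurePreserving_sumPiEquivProdPi
    (fun _ : (Fin N × Fin M) ⊕ Fin N => stdComplexGaussian)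
  have hmp3 := (map_curry_swap_pi stdComplexGaussian N M).prod
    (MeasurePreserving.id (gaussianVec N))
  have hmp4 := (MeasurePreserving.id (gaussianVec N)).prod (hmp3.comp hmp2)
  have hmp5 := (measurePreserving_prodAssoc (gaussianVec N) (gaussianCols N M)
    (gaussianVec N)).symm
  have hmp := hmp5.comp (hmp4.comp hmp1)
  have hlaw := hmp.hasLaw.comp hall
  exact hlaw

end ChannelLaw

/-! ### Tail probability under the product law. -/

section JointTail

lemma measurableSet_whitenedPower_gt {N M : ℕ} {ρ : ℝ} (hρ : 0 ≤ ρ) (x : ℝ) :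
    MeasurableSet {p : (Fin N → ℂ) × (Fin M → Fin N → ℂ) | x < whitenedPower ρ p.1 p.2} :=
  measurableSet_lt measurable_const (measurable_whitenedPower hρ)

lemma prod_real_whitenedPower_gt (n M : ℕ) {ρ x : ℝ} (hρ : 0 ≤ ρ) (hx : 0 ≤ x) :
    ((gaussianVec (n + 1)).prod (gaussianCols (n + 1) M)).real
      {p | x < whitenedPower ρ p.1 p.2} = tailFun ρ M (n + 1) x := by
  rw [measureReal_def, Measure.prod_apply_symm (measurableSet_whitenedPower_gt hρ x)]
  have h := lintegral_gaussianVec_whitenedPower_gt n M hρ hx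
  simp only [Set.preimage_ofPred_eq]
  rw [h, ENNReal.toReal_ofReal (tailFun_nonneg hρ M (n + 1) hx)]

end JointTail

/-! ### The distribution of Z and the outage bound. -/

theorem corollary2 {Ω : Type*} [MeasurableSpace Ω] (μ : Measure Ω) [IsProbabilityMeasure μ]
    (N M : ℕ) (hN : 1 ≤ N) (hM : 1 ≤ M)
    (h₁ : Ω → Fin N → ℂ) (H : Ω → Matrix (Fin N) (Fin M) ℂ) (h₂ : Ω → Fin N → ℂ)
    (hfading : IsRayleighFading μ h₁ H h₂)
    (Ps Pr PI N₀ : ℝ) (hPs : 0 < Ps) (hPr : 0 < Pr) (hPI : 0 < PI) (hN₀ : 0 < N₀)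
    (ρ₁ ρ₂ ρI : ℝ) (hρ₁ : ρ₁ = Ps / N₀) (hρ₂ : ρ₂ = Pr / N₀) (hρI : ρI = PI / N₀) :
    (∀ z : ℝ, 0 ≤ z → μ.real {ω | mmseZ ρ₁ ρI (h₁ ω) (H ω) ≤ z} = mmseCdf N M ρ₁ ρI z) ∧
    ∀ γth : ℝ, 0 < γth →
      1 - upperIncompleteGamma N (γth / ρ₂) / Real.Gamma N * (1 - mmseCdf N M ρ₁ ρI γth)
        ≤ mmseMrtOutage μ h₁ H h₂ Ps Pr PI N₀ γth := by
  have hρ₁0 : 0 < ρ₁ := by rw [hρ₁]; positivity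
  have hρ₂0 : 0 < ρ₂ := by rw [hρ₂]; positivity
  have hρI0 : 0 < ρI := by rw [hρI]; positivity
  obtain ⟨n, rfl⟩ := Nat.exists_eq_add_of_le' hN
  have hlaw := hfading.hasLaw_channels
  have hset := fun x => measurableSet_whitenedPower_gt (N := n + 1) (M := M) hρI0.le x
  constructor
  · intro z hz
    have hx : 0 ≤ z / ρ₁ := by positivity
    have hS : MeasurableSet {p : ((Fin (n + 1) → ℂ) × (Fin M → Fin (n + 1) → ℂ)) ×
        (Fin (n + 1) → ℂ) | z / ρ₁ < whitenedPower ρI p.1.1 p.1.2} :=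
      measurable_fst (hset (z / ρ₁))
    have hpre : {ω | mmseZ ρ₁ ρI (h₁ ω) (H ω) ≤ z} = (fun ω => ((h₁ ω, (H ω).col), h₂ ω)) ⁻¹'
        {p | z / ρ₁ < whitenedPower ρI p.1.1 p.1.2}ᶜ := by
      ext ω
      simp only [Set.mem_ofPred_eq, Set.mem_preimage, Set.mem_compl_iff, not_lt,
        mmseZ_eq ρ₁ hρI0, le_div_iff₀' hρ₁0]
    have hprod : {p : ((Fin (n + 1) → ℂ) × (Fin M → Fin (n + 1) → ℂ)) ×
        (Fin (n + 1) → ℂ) | z / ρ₁ < whitenedPower ρI p.1.1 p.1.2} =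
        {p | z / ρ₁ < whitenedPower ρI p.1 p.2} ×ˢ Set.univ := by
      ext p; simp
    rw [hpre, ← map_measureReal_apply_of_aemeasurable hlaw.aemeasurable hS.compl, hlaw.map_eq,
      probReal_compl_eq_one_sub hS, hprod, measureReal_prod_prod, probReal_univ, mul_one,
      prod_real_whitenedPower_gt n M hρI0.le hx, mmseCdf_eq _ _ hN hρ₁0 hρI0 hz]
  · intro γ hγ
    have hx : 0 ≤ γ / ρ₁ := by positivity
    have ht : 0 ≤ γ / ρ₂ := by positivity
    have hset₂ : MeasurableSet {k : Fin (n + 1) → ℂ | γ / ρ₂ < frobSq k} :=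
      measurableSet_lt measurable_const measurable_frobSq
    have hS := (hset (γ / ρ₁)).prod hset₂
    have hg : (gaussianVec (n + 1)).real {k | γ / ρ₂ < frobSq k} =
        tailFun 0 0 (n + 1) (γ / ρ₂) := by
      rw [measureReal_def, gaussianVec_frobSq_gt n ht,
        ENNReal.toReal_ofReal (tailFun_nonneg le_rfl 0 (n + 1) ht)]
    -- Only this inclusion is used, hence a lower bound. The complement is a measurable rectangle,
    -- so its probability is the product of the two tails.
    have hsub : (fun ω => ((h₁ ω, (H ω).col), h₂ ω)) ⁻¹'
        ({p | γ / ρ₁ < whitenedPower ρI p.1 p.2} ×ˢ {k | γ / ρ₂ < frobSq k})ᶜ ⊆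
        {ω | mmseMrtSINR Ps Pr PI N₀ (h₁ ω) (H ω) (h₂ ω) < γ} := by
      intro ω hω
      simp only [Set.mem_preimage, Set.mem_compl_iff, Set.mem_prod, Set.mem_ofPred_eq,
        not_and_or, not_lt, le_div_iff₀' hρ₁0, le_div_iff₀' hρ₂0] at hω
      rw [hρ₁, hρ₂, hρI] at hω
      exact mmseMrtSINR_lt hPs hPr hPI hN₀ hγ _ _ _ hω
    rw [mmseMrtOutage]
    refine le_trans (le_of_eq ?_) (measureReal_mono hsub)
    rw [← map_measureReal_apply_of_aemeasurable hlaw.aemeasurable hS.compl, hlaw.map_eq,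
      probReal_compl_eq_one_sub hS, measureReal_prod_prod,
      prod_real_whitenedPower_gt n M hρI0.le hx, hg, mmseCdf_eq _ _ hN hρ₁0 hρI0 hγ.le,
      upperIncompleteGamma_div_Gamma n ht]
    ring
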